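/- Let $0<k<n$ be fixed integers and let $f_1,f_2$ be probability distributions on $\mathbb{R}$. For each $k$-element set $K\subseteq\{1,\dots,n\}$ let $H_K$ be the hypothesis that $X_1,\dots,X_n$ are independent with $X_i\sim f_2$ for $i\in K$ and $X_i\sim f_1$ for $i\notin K$; there are $l=\binom nk$ hypotheses, written $H_1,\dots,H_l$. For $a\in\mathbb{R}^n$ let $p_{Y|A=a,H_v}$ be the distribution of $Y=\langle a,X\rangle$ under $H_v$; powers of distributions below are powers of their densities with respect to a common dominating measure, and the integrals do not depend on its choice. Let $p_A$ be a finitely supported probability distribution on $\mathbb{R}^n$. Let $M\subseteq\mathbb{N}$ be an infinite set of sample sizes such that for each $m\in M$ there are predetermined sensing vectors $a^1,\dots,a^m$ (they may depend on $m$) in which every vector $a$ occurs exactly $P(A=a)\,m$ times (in particular these numbers are integers). One observes $Y^j=\langle a^j,X^j\rangle$, $1\le j\le m$, where $X^1,\dots,X^m$ are independent copies of $X$, and estimates $K$ by $\hat K=\varphi(Y^1,\dots,Y^m)$ with a measurable decision function $\varphi$. The outer conditional Chernoff information of two hypotheses is $$OC(p_{Y|A,H_v},p_{Y|A,H_w})=-\inf_{0\le\lambda\le1}E_A\Big[\log\int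 p_{Y|A,H_v}^{\lambda}(y)\,p_{Y|A,H_w}^{1-\lambda}(y)\,dy\Big]\in[0,\infty],$$ with natural logarithms, $\log 0=-\infty$ and $0^0=1$. Put $$E=\min_{v\ne w}OC(p_{Y|A,H_v},p_{Y|A,H_w})\in[0,\infty].$$ Then the error exponent of hypothesis testing is exactly $E$: 1. $\lim_{m\to\infty,\,m\in M}-\frac1m\log\big(\inf_\varphi\max_v P(\hat K\ne K\mid H_v)\big)=E$. 2. For every prior $\pi$ on the hypotheses with $\pi_v>0$ for all $v$, $\lim_{m\to\infty,\,m\in M}-\frac1m\log\big(\inf_\varphi\sum_v\pi_v P(\hat K\ne K\mid H_v)\big)=E$. 3. If for each $m\in M$ the decision function is a likelihood ratio test (it chooses a hypothesis of maximum likelihood given $Y^1,\dots,Y^m$, ties being broken in any measurable way), then $\lim_{m\to\infty,\,m\in M}-\frac1m\log\big(\max_v P(\hat K\ne K\mid H_v)\big)=E$. Moreover, let $p_\lambda(\cdot|a)$ denote the normalization of $p_{Y|A=a,H_v}^\lambda\,p_{Y|A=a,H_w}^{1-\lambda}$ to a probability distribution, which is possible if the integral of this function is positive, and let $D(\cdot\,\|\,\cdot)$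 be the relative entropy. 4. If $\lambda\in[0,1]$ is such that $p_\lambda(\cdot|a)$ exists for every $a$ with $P(A=a)>0$ and $E_A[D(p_\lambda\|p_{Y|A,H_v})]=E_A[D(p_\lambda\|p_{Y|A,H_w})]$, then $OC(p_{Y|A,H_v},p_{Y|A,H_w})$ is equal to this common value. 5. Such a $\lambda$ exists whenever, for every $a$ with $P(A=a)>0$, the distributions $p_{Y|A=a,H_v}$ and $p_{Y|A=a,H_w}$ are mutually absolutely continuous. -/

import Mathlib

open MeasureTheory Filter Topology
open scoped NNReal ENNReal

namespace CompressedTesting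

noncomputable section

/-- The hypotheses `H_K`: one for every `k`-element set `K` of anomalous indices. -/
abbrev Hypothesis (n k : ℕ) : Type := {K : Finset (Fin n) // K.card = k}

/-- The law of `X = (X₁, …, Xₙ)` when `K` is the set of anomalous indices: the components are
independent, `X i ∼ f₂` for `i ∈ K` and `X i ∼ f₁` for `i ∉ K`. -/
def signalLaw {n : ℕ} (f₁ f₂ : Measure ℝ) (K : Finset (Fin n)) : Measure (Fin n → ℝ) :=
  Measure.pi fun i => if i ∈ K then f₂ else f₁

/-- The law `p_{Y | A = a, H_K}` of one mixed observation `Y = ⟨a, X⟩ = ∑ i, a i * X i`. -/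
def obsLaw {n : ℕ} (f₁ f₂ : Measure ℝ) (K : Finset (Fin n)) (a : Fin n → ℝ) : Measure ℝ :=
  (signalLaw f₁ f₂ K).map fun x => ∑ i, a i * x i

/-- The law of `(Y¹, …, Yᵐ)` under `H_K` when the predetermined sensing vectors are
`s 0, …, s (m - 1)`; the realizations at different times are independent. -/
def dataLaw {n m : ℕ} (f₁ f₂ : Measure ℝ) (s : Fin m → Fin n → ℝ) (K : Finset (Fin n)) :
    Measure (Fin m → ℝ) :=
  Measure.pi fun j => obsLaw f₁ f₂ K (s j)

/-- Among the `m` predetermined sensing vectors, each vector `a` occurs exactly `P(A = a) m`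
times. -/
def IsSchedule {n m : ℕ} (pA : (Fin n → ℝ) →₀ ℝ≥0) (s : Fin m → Fin n → ℝ) : Prop :=
  ∀ a : Fin n → ℝ, ({j : Fin m | s j = a}.ncard : ℝ≥0) = pA a * (m : ℝ≥0)

/-- The unnormalized density `p^λ q^(1-λ)`, where `p`, `q` are the densities of `P`, `Q` with
respect to the common dominating measure `P + Q`. -/
def geomDensity (P Q : Measure ℝ) (lam : ℝ) (y : ℝ) : ℝ≥0∞ :=
  P.rnDeriv (P + Q) y ^ lam * Q.rnDeriv (P + Q) y ^ (1 - lam)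

/-- `∫ p^λ q^(1-λ)` (it does not depend on the choice of the dominating measure). -/
def affinity (P Q : Measure ℝ) (lam : ℝ) : ℝ≥0∞ :=
  ∫⁻ y, geomDensity P Q lam y ∂(P + Q)

/-- The normalized geometric mixture `p_λ = p^λ q^(1-λ) / ∫ p^λ q^(1-λ)`. -/
def geomMixture (P Q : Measure ℝ) (lam : ℝ) : Measure ℝ :=
  (affinity P Q lam)⁻¹ • (P + Q).withDensity (geomDensity P Q lam)

/-- The outer conditional Chernoff information
`OC = - inf_{0 ≤ λ ≤ 1} E_A [log ∫ p_{Y|A,H_v}^λ p_{Y|A,H_w}^(1-λ)]` (natural logarithm,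
`log 0 = -∞`), where `P a` and `Q a` are the laws of `Y` given `A = a` under the two
hypotheses. -/
def outerChernoff {n : ℕ} (pA : (Fin n → ℝ) →₀ ℝ≥0) (P Q : (Fin n → ℝ) → Measure ℝ) : EReal :=
  -⨅ lam ∈ Set.Icc (0 : ℝ) 1,
    pA.sum fun a p => ((p : ℝ) : EReal) * ENNReal.log (affinity (P a) (Q a) lam)

/-- `E_A [D(p_λ(· | A) ‖ R(· | A))]`, where `p_λ` is the geometric mixture of `P` and `Q`. -/
def meanDiv {n : ℕ} (pA : (Fin n → ℝ) →₀ ℝ≥0) (P Q R : (Fin n → ℝ) → Measure ℝ) (lam : ℝ) :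
    ℝ≥0∞ :=
  pA.sum fun a p => (p : ℝ≥0∞) * InformationTheory.klDiv (geomMixture (P a) (Q a) lam) (R a)

/-- The parameter `λ ∈ [0, 1]` is balanced if the mixtures `p_λ(· | a)` exist and
`Q_{λ, v → w} = Q_{λ, w → v}`. -/
def IsBalanced {n : ℕ} (pA : (Fin n → ℝ) →₀ ℝ≥0) (P Q : (Fin n → ℝ) → Measure ℝ) (lam : ℝ) :
    Prop :=
  lam ∈ Set.Icc (0 : ℝ) 1 ∧ (∀ a ∈ pA.support, affinity (P a) (Q a) lam ≠ 0) ∧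
    meanDiv pA P Q P lam = meanDiv pA P Q Q lam

/-- A decision rule `K̂ = φ(Y¹, …, Yᵐ)`. A value that is not a `k`-element set is a declared
failure. -/
abbrev DecisionRule (n m : ℕ) : Type :=
  {φ : (Fin m → ℝ) → Finset (Fin n) // ∀ K, MeasurableSet (φ ⁻¹' {K})}

/-- The probability that `K̂ ≠ K` when `H_K` is true. -/
def errorProb {n m : ℕ} (f₁ f₂ : Measure ℝ) (s : Fin m → Fin n → ℝ) (φ : DecisionRule n m)
    (K : Finset (Fin n)) : ℝ≥0∞ :=
  dataLaw f₁ f₂ s K {y | φ.1 y ≠ K}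

/-- The largest error probability of a decision rule over all hypotheses. -/
def worstError {n m : ℕ} (k : ℕ) (f₁ f₂ : Measure ℝ) (s : Fin m → Fin n → ℝ)
    (φ : DecisionRule n m) : ℝ≥0∞ :=
  ⨆ v : Hypothesis n k, errorProb f₁ f₂ s φ v.1

/-- The average error probability of a decision rule under a prior on the hypotheses. -/
def bayesError {n m k : ℕ} (f₁ f₂ : Measure ℝ) (s : Fin m → Fin n → ℝ)
    (prior : PMF (Hypothesis n k)) (φ : DecisionRule n m) : ℝ≥0∞ :=
  ∑ v : Hypothesis n k, prior v * errorProb f₁ f₂ s φ v.1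

/-- The likelihood `p(y¹, …, yᵐ | H_K)`, as a density with respect to the sum of the laws of the
data under all hypotheses. -/
def likelihood {n m : ℕ} (k : ℕ) (f₁ f₂ : Measure ℝ) (s : Fin m → Fin n → ℝ)
    (K : Finset (Fin n)) : (Fin m → ℝ) → ℝ≥0∞ :=
  (dataLaw f₁ f₂ s K).rnDeriv (∑ v : Hypothesis n k, dataLaw f₁ f₂ s v.1)

/-- `φ` is a likelihood ratio test: it chooses a hypothesis of maximum likelihood (with any way of
breaking ties). -/
def IsLikelihoodRatioTest {n m : ℕ} (k : ℕ) (f₁ f₂ : Measure ℝ) (s : Fin m → Fin n → ℝ)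
    (φ : DecisionRule n m) : Prop :=
  ∀ᵐ y ∂(∑ v : Hypothesis n k, dataLaw f₁ f₂ s v.1),
    ∃ v : Hypothesis n k, φ.1 y = v.1 ∧
      ∀ w : Hypothesis n k, likelihood k f₁ f₂ s w.1 y ≤ likelihood k f₁ f₂ s v.1 y

/-- `-(1/m) log p`, with value `+∞` at `p = 0` (for `m > 0`). -/
def errorRate (m : ℕ) (p : ℝ≥0∞) : EReal := -ENNReal.log p / ((m : ℝ) : EReal)

/-- The claimed exponent `min_{v ≠ w} OC(p_{Y|A,H_v}, p_{Y|A,H_w})`. -/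
def minOuterChernoff {n : ℕ} (k : ℕ) (f₁ f₂ : Measure ℝ) (pA : (Fin n → ℝ) →₀ ℝ≥0) : EReal :=
  ⨅ (v : Hypothesis n k) (w : Hypothesis n k) (_ : v ≠ w),
    outerChernoff pA (obsLaw f₁ f₂ v.1) (obsLaw f₁ f₂ w.1)

end

end CompressedTesting

open CompressedTesting

namespace CompressedTesting

/-- Tonelli's theorem for a product of functions of one coordinate each. -/
theorem lintegral_pi_prod {α : Type*} [MeasurableSpace α] {m : ℕ} (μ : Fin m → Measure α)
    [∀ i, SigmaFinite (μ i)] {f : Fin m → α → ℝ≥0∞} (hf : ∀ i, Measurable (f i)) :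
    ∫⁻ x, ∏ i, f i (x i) ∂Measure.pi μ = ∏ i, ∫⁻ y, f i y ∂μ i := by
  induction m with
  | zero => simp
  | succ m ih =>
    have hprod : Measurable fun x : Fin m → α => ∏ i : Fin m, f (Fin.succ i) (x i) :=
      Finset.measurable_prod _ fun i _ => (hf _).comp (measurable_pi_apply i)
    calc
      _ = ∫⁻ x : α × (Fin m → α), f 0 x.1 * ∏ i : Fin m, f (Fin.succ i) (x.2 i)
            ∂((μ 0).prod (Measure.pi (fun i ↦ μ i.succ))) := by
          rw [← ((measurePreserving_piFinSuccAbove μ 0).symm).lintegral_comp_emb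
            (MeasurableEquiv.measurableEmbedding _)]
          simp_rw [MeasurableEquiv.piFinSuccAbove_symm_apply, Fin.insertNthEquiv,
            Fin.prod_univ_succ, Fin.insertNth_zero, Equiv.coe_fn_mk, Fin.cons_succ,
            Fin.zero_succAbove, Fin.cons_zero]
          rfl
      _ = _ := by
          rw [lintegral_prod_mul (hf 0).aemeasurable hprod.aemeasurable,
            ih (fun i => μ i.succ) (fun i => hf i.succ), Fin.prod_univ_succ]

/-- The product of measures with densities has the product density. -/
theorem pi_withDensity_eq {α : Type*} [MeasurableSpace α] {m : ℕ} (μ : Fin m → Measure α)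
    [∀ i, SigmaFinite (μ i)] {f : Fin m → α → ℝ≥0∞} (hf : ∀ i, Measurable (f i))
    [∀ i, SigmaFinite ((μ i).withDensity (f i))] :
    Measure.pi (fun i => (μ i).withDensity (f i)) =
      (Measure.pi μ).withDensity fun x => ∏ i, f i (x i) := by
  symm
  refine (Measure.pi_eq fun t ht => ?_).symm
  rw [withDensity_apply _ (MeasurableSet.univ_pi ht), ← lintegral_indicator
    (MeasurableSet.univ_pi ht)]
  have : (fun x : Fin m → α => (Set.univ.pi t).indicator (fun x => ∏ i, f i (x i)) x) =
      fun x => ∏ i, (t i).indicator (f i) (x i) := by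
    funext x
    by_cases hx : x ∈ Set.univ.pi t
    · rw [Set.indicator_of_mem hx]
      exact Finset.prod_congr rfl fun i _ => by
        rw [Set.indicator_of_mem (hx i (Set.mem_univ i))]
    · rw [Set.indicator_of_notMem hx]
      simp only [Set.mem_univ_pi, not_forall] at hx
      obtain ⟨i, hi⟩ := hx
      exact (Finset.prod_eq_zero (Finset.mem_univ i) (Set.indicator_of_notMem hi _)).symm
  rw [this, lintegral_pi_prod μ fun i => (hf i).indicator (ht i)]
  exact Finset.prod_congr rfl fun i _ => by
    rw [lintegral_indicator (ht i), withDensity_apply _ (ht i)]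

/-- `∫ p^λ q^(1-λ)` does not depend on the dominating measure. -/
theorem lintegral_geom_withDensity {α : Type*} [MeasurableSpace α] {ν P Q : Measure α}
    [IsFiniteMeasure P] [IsFiniteMeasure Q] {f g : α → ℝ≥0∞}
    (hf : Measurable f) (hg : Measurable g) (hP : P = ν.withDensity f) (hQ : Q = ν.withDensity g)
    {lam : ℝ} (hlam : lam ∈ Set.Icc (0 : ℝ) 1) :
    ∫⁻ y, P.rnDeriv (P + Q) y ^ lam * Q.rnDeriv (P + Q) y ^ (1 - lam) ∂(P + Q) =
      ∫⁻ y, f y ^ lam * g y ^ (1 - lam) ∂ν := by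
  have hsum : P + Q = ν.withDensity (f + g) := by
    rw [hP, hQ, withDensity_add_left hf]
  have hfin : ∀ᵐ y ∂ν, f y + g y < ∞ := by
    refine ae_lt_top (hf.add hg) ?_
    have h : (P + Q) Set.univ ≠ ∞ := measure_ne_top _ _
    rwa [hsum, withDensity_apply _ MeasurableSet.univ, setLIntegral_univ] at h
  have key : ∀ h : α → ℝ≥0∞, Measurable h → h ≤ f + g →
      (ν.withDensity h).rnDeriv (P + Q) =ᵐ[P + Q] fun y => h y / (f y + g y) := by
    intro h hh hle
    have : ν.withDensity h = (P + Q).withDensity fun y => h y / (f y + g y) := by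
      change _ = (P + Q).withDensity (h / (f + g))
      rw [hsum, ← withDensity_mul _ (hf.add hg) (hh.div (hf.add hg))]
      refine withDensity_congr_ae ?_
      filter_upwards [hfin] with y hy
      simp only [Pi.mul_apply, Pi.add_apply, Pi.div_apply]
      by_cases h0 : f y + g y = 0
      · have := hle y
        simp only [Pi.add_apply, h0, nonpos_iff_eq_zero] at this
        simp [this]
      · rw [ENNReal.mul_div_cancel h0 hy.ne]
    rw [this]
    exact Measure.rnDeriv_withDensity _ (hh.div (hf.add hg))
  have hPd := key f hf (fun y => le_self_add)
  have hQd := key g hg (fun y => le_add_self)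
  rw [← hP] at hPd
  rw [← hQ] at hQd
  have h1 : ∫⁻ y, P.rnDeriv (P + Q) y ^ lam * Q.rnDeriv (P + Q) y ^ (1 - lam) ∂(P + Q) =
      ∫⁻ y, (f y / (f y + g y)) ^ lam * (g y / (f y + g y)) ^ (1 - lam) ∂(P + Q) := by
    refine lintegral_congr_ae ?_
    filter_upwards [hPd, hQd] with y h1 h2
    rw [h1, h2]
  rw [h1, hsum, lintegral_withDensity_eq_lintegral_mul _ (hf.add hg) (by fun_prop)]
  refine lintegral_congr_ae ?_
  filter_upwards [hfin] with y hy
  simp only [Pi.mul_apply, Pi.add_apply]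
  by_cases h0 : f y + g y = 0
  · have hf0 : f y = 0 := by simpa using (add_eq_zero.1 h0).1
    have hg0 : g y = 0 := by simpa using (add_eq_zero.1 h0).2
    rw [h0, hf0, hg0, zero_mul]
    symm
    rcases eq_or_lt_of_le hlam.1 with h | h
    · simp [← h]
    · simp [ENNReal.zero_rpow_of_pos h]
  · have hl := hlam.1
    have hl' : 0 ≤ 1 - lam := by linarith [hlam.2]
    rw [ENNReal.div_rpow_of_nonneg _ _ hl, ENNReal.div_rpow_of_nonneg _ _ hl']
    have hs : f y + g y = (f y + g y) ^ lam * (f y + g y) ^ (1 - lam) := by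
      rw [← ENNReal.rpow_add_of_nonneg _ _ hl hl']; simp
    have ha0 : (f y + g y) ^ lam ≠ 0 := by simp [h0, hy.ne]
    have hat : (f y + g y) ^ lam ≠ ∞ := ENNReal.rpow_ne_top_of_nonneg hl hy.ne
    have hb0 : (f y + g y) ^ (1 - lam) ≠ 0 := by simp [h0, hy.ne]
    have hbt : (f y + g y) ^ (1 - lam) ≠ ∞ := ENNReal.rpow_ne_top_of_nonneg hl' hy.ne
    calc _ = (f y + g y) ^ lam * (f y + g y) ^ (1 - lam) *
          (f y ^ lam / (f y + g y) ^ lam * (g y ^ (1 - lam) / (f y + g y) ^ (1 - lam))) := by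
          rw [← hs]
      _ = ((f y + g y) ^ lam * (f y ^ lam / (f y + g y) ^ lam)) *
          ((f y + g y) ^ (1 - lam) * (g y ^ (1 - lam) / (f y + g y) ^ (1 - lam))) := by ring
      _ = _ := by rw [ENNReal.mul_div_cancel ha0 hat, ENNReal.mul_div_cancel hb0 hbt]

/-- `S` carries the part that `P` and `Q` have in common, and `l` is their log-likelihood ratio on
`S`. -/
structure IsCommonPart (P Q : Measure ℝ) (S : Set ℝ) (l : ℝ → ℝ) : Prop where
  measurableSet : MeasurableSet S
  measurable : Measurable l
  restrict_eq : P.restrict S = (Q.restrict S).withDensity fun y => ENNReal.ofReal (Real.exp (l y))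
  withDensity_geom : ∀ lam ∈ Set.Ioo (0 : ℝ) 1, (P + Q).withDensity (geomDensity P Q lam) =
    (Q.restrict S).withDensity fun y => ENNReal.ofReal (Real.exp (lam * l y))
  restrict_eq_self : P ≪ Q → Q ≪ P → P.restrict S = P ∧ Q.restrict S = Q

theorem exists_isCommonPart (P Q : Measure ℝ) [IsFiniteMeasure P] [IsFiniteMeasure Q] :
    ∃ (S : Set ℝ) (l : ℝ → ℝ), IsCommonPart P Q S l := by
  set p := P.rnDeriv (P + Q) with hp
  set q := Q.rnDeriv (P + Q) with hq
  have hpm : Measurable p := Measure.measurable_rnDeriv _ _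
  have hqm : Measurable q := Measure.measurable_rnDeriv _ _
  have hPp : (P + Q).withDensity p = P := Measure.withDensity_rnDeriv_eq _ _
    (Measure.AbsolutelyContinuous.rfl.add_right Q)
  have hQq : (P + Q).withDensity q = Q := Measure.withDensity_rnDeriv_eq _ _
    (Measure.absolutelyContinuous_of_le (Measure.le_add_left le_rfl))
  have hpt : ∀ᵐ y ∂(P + Q), p y < ∞ := Measure.rnDeriv_lt_top _ _
  have hqt : ∀ᵐ y ∂(P + Q), q y < ∞ := Measure.rnDeriv_lt_top _ _
  set S : Set ℝ := {y | (p y ≠ 0 ∧ p y ≠ ∞) ∧ q y ≠ 0 ∧ q y ≠ ∞} with hS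
  set l : ℝ → ℝ := fun y => Real.log (p y).toReal - Real.log (q y).toReal with hl
  have hSm : MeasurableSet S :=
    ((measurableSet_eq_fun hpm measurable_const).compl.inter
      (measurableSet_eq_fun hpm measurable_const).compl).inter
    ((measurableSet_eq_fun hqm measurable_const).compl.inter
      (measurableSet_eq_fun hqm measurable_const).compl)
  have hlm : Measurable l := by fun_prop
  have hexp : ∀ y ∈ S, ∀ lam : ℝ,
      q y * ENNReal.ofReal (Real.exp (lam * l y)) = p y ^ lam * q y ^ (1 - lam) := by
    intro y hy lam
    have ha : 0 < (p y).toReal := ENNReal.toReal_pos hy.1.1 hy.1.2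
    have hb : 0 < (q y).toReal := ENNReal.toReal_pos hy.2.1 hy.2.2
    rw [← ENNReal.ofReal_toReal hy.1.2, ← ENNReal.ofReal_toReal hy.2.2,
      ENNReal.ofReal_rpow_of_pos ha, ENNReal.ofReal_rpow_of_pos hb,
      ← ENNReal.ofReal_mul hb.le, ← ENNReal.ofReal_mul (by positivity),
      Real.rpow_def_of_pos ha, Real.rpow_def_of_pos hb, ← Real.exp_add]
    nth_rewrite 1 [← Real.exp_log hb]
    rw [← Real.exp_add]
    congr 2
    simp only [hl]
    ring
  have hN : ∀ h : ℝ → ℝ≥0∞, Measurable h → (Q.restrict S).withDensity h =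
      (P + Q).withDensity (S.indicator fun y => q y * h y) := by
    intro h hh
    have : (S.indicator fun y => q y * h y) = S.indicator q * h := by
      funext y
      by_cases hy : y ∈ S <;> simp [hy]
    have hres : (P + Q).withDensity (S.indicator q) = Q.restrict S := by
      rw [withDensity_indicator hSm, ← restrict_withDensity hSm, hQq]
    rw [this, withDensity_mul _ (hqm.indicator hSm) hh, hres]
  refine ⟨S, l, hSm, hlm, ?_, fun lam hlam => ?_, fun hPQ hQP => ?_⟩
  · rw [hN _ (by fun_prop)]
    nth_rewrite 1 [← hPp]
    rw [restrict_withDensity hSm, ← withDensity_indicator hSm]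
    congr 1
    refine Set.indicator_congr fun y hy => ?_
    have := hexp y hy 1
    simpa using this.symm
  · rw [hN _ (by fun_prop)]
    refine withDensity_congr_ae ?_
    filter_upwards [hpt, hqt] with y h1 h2
    by_cases hy : y ∈ S
    · rw [Set.indicator_of_mem hy, hexp y hy]
      rfl
    · rw [Set.indicator_of_notMem hy]
      have : p y = 0 ∨ q y = 0 := by
        by_contra! hc
        exact hy ⟨⟨hc.1, h1.ne⟩, hc.2, h2.ne⟩
      change p y ^ lam * q y ^ (1 - lam) = 0
      rcases this with h | h
      · rw [h, ENNReal.zero_rpow_of_pos hlam.1, zero_mul]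
      · rw [h, ENNReal.zero_rpow_of_pos (by linarith [hlam.2]), mul_zero]
  · have hz : ∀ (f : ℝ → ℝ≥0∞), Measurable f →
        ((P + Q).withDensity f) {y | f y = 0} = 0 := by
      intro f hf
      rw [withDensity_apply _ (measurableSet_eq_fun hf measurable_const)]
      exact setLIntegral_eq_zero (measurableSet_eq_fun hf measurable_const) fun y hy => hy
    have h1 : P {y | p y = 0} = 0 := by have := hz p hpm; rwa [hPp] at this
    have h2 : Q {y | q y = 0} = 0 := by have := hz q hqm; rwa [hQq] at this
    have hPS : ∀ R : Measure ℝ, R ≪ P → R ≪ Q → R ≪ P + Q → R.restrict S = R := by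
      intro R hRP hRQ hR
      refine Measure.restrict_eq_self_of_ae_mem ?_
      filter_upwards [measure_eq_zero_iff_ae_notMem.1 (hRP h1),
        measure_eq_zero_iff_ae_notMem.1 (hRQ h2), hR.ae_le hpt, hR.ae_le hqt] with y a b c d
      exact ⟨⟨a, c.ne⟩, b, d.ne⟩
    exact ⟨hPS P .rfl hPQ (Measure.AbsolutelyContinuous.rfl.add_right Q),
      hPS Q hQP .rfl (Measure.absolutelyContinuous_of_le (Measure.le_add_left le_rfl))⟩

instance isProbabilityMeasure_ite {ι : Type*} [DecidableEq ι] (K : Finset ι) (i : ι)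
    (f₁ f₂ : Measure ℝ) [IsProbabilityMeasure f₁] [IsProbabilityMeasure f₂] :
    IsProbabilityMeasure (if i ∈ K then f₂ else f₁) := by
  split_ifs <;> infer_instance

instance isProbabilityMeasure_signalLaw {n : ℕ} (f₁ f₂ : Measure ℝ) [IsProbabilityMeasure f₁]
    [IsProbabilityMeasure f₂] (K : Finset (Fin n)) :
    IsProbabilityMeasure (signalLaw f₁ f₂ K) := by
  unfold signalLaw; infer_instance

instance isProbabilityMeasure_obsLaw {n : ℕ} (f₁ f₂ : Measure ℝ) [IsProbabilityMeasure f₁]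
    [IsProbabilityMeasure f₂] (K : Finset (Fin n)) (a : Fin n → ℝ) :
    IsProbabilityMeasure (obsLaw f₁ f₂ K a) :=
  Measure.isProbabilityMeasure_map (Measurable.aemeasurable (by fun_prop))

instance isProbabilityMeasure_dataLaw {n m : ℕ} (f₁ f₂ : Measure ℝ) [IsProbabilityMeasure f₁]
    [IsProbabilityMeasure f₂] (s : Fin m → Fin n → ℝ) (K : Finset (Fin n)) :
    IsProbabilityMeasure (dataLaw f₁ f₂ s K) := by
  unfold dataLaw; infer_instance

theorem IsSchedule.mem_support {n m : ℕ} {pA : (Fin n → ℝ) →₀ ℝ≥0} {s : Fin m → Fin n → ℝ}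
    (hs : IsSchedule pA s) (j : Fin m) : s j ∈ pA.support := by
  rw [Finsupp.mem_support_iff]
  intro h0
  have h := hs (s j)
  rw [h0, zero_mul, Nat.cast_eq_zero, Set.ncard_eq_zero (Set.toFinite _)] at h
  exact (Set.eq_empty_iff_forall_notMem.1 h j) rfl

/-- Grouping a product over a schedule by the sensing vectors. -/
@[to_additive /-- Grouping a sum over a schedule by the sensing vectors. -/]
theorem IsSchedule.prod_eq {n m : ℕ} {pA : (Fin n → ℝ) →₀ ℝ≥0} {s : Fin m → Fin n → ℝ}
    (hs : IsSchedule pA s) {R : Type*} [CommMonoid R] (f : (Fin n → ℝ) → R) :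
    ∏ j, f (s j) = ∏ a ∈ pA.support, f a ^ {j : Fin m | s j = a}.ncard := by
  classical
  have hmem : ∀ j ∈ Finset.univ, s j ∈ pA.support := fun j _ => hs.mem_support j
  rw [← Finset.prod_fiberwise_of_maps_to' hmem]
  refine Finset.prod_congr rfl fun a _ => ?_
  rw [Finset.prod_const, Set.ncard_eq_toFinset_card']
  congr 2
  ext j
  simp

theorem IsSchedule.prod_ennreal {n m : ℕ} {pA : (Fin n → ℝ) →₀ ℝ≥0} {s : Fin m → Fin n → ℝ}
    (hs : IsSchedule pA s) (f : (Fin n → ℝ) → ℝ≥0∞) :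
    ∏ j, f (s j) = (∏ a ∈ pA.support, f a ^ (pA a : ℝ)) ^ m := by
  rw [hs.prod_eq, ← Finset.prod_pow]
  refine Finset.prod_congr rfl fun a _ => ?_
  have h : (({j : Fin m | s j = a}.ncard : ℝ≥0) : ℝ) = (pA a : ℝ) * m := by
    rw [hs a]; simp
  rw [← ENNReal.rpow_natCast, ← ENNReal.rpow_natCast, ← ENNReal.rpow_mul, ← h]
  simp

theorem IsSchedule.sum_real {n m : ℕ} {pA : (Fin n → ℝ) →₀ ℝ≥0} {s : Fin m → Fin n → ℝ}
    (hs : IsSchedule pA s) (f : (Fin n → ℝ) → ℝ) :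
    ∑ j, f (s j) = m * ∑ a ∈ pA.support, (pA a : ℝ) * f a := by
  rw [hs.sum_eq, Finset.mul_sum]
  refine Finset.sum_congr rfl fun a _ => ?_
  have h : (({j : Fin m | s j = a}.ncard : ℝ≥0) : ℝ) = (pA a : ℝ) * m := by
    rw [hs a]; simp
  have h' : ({j : Fin m | s j = a}.ncard : ℝ) = (pA a : ℝ) * m := by exact_mod_cast h
  rw [nsmul_eq_mul, h']
  ring

/-- The weighted geometric mean `exp E_A [log ∫ p^λ q^(1-λ)]` of the affinities. -/
noncomputable def meanAffinity {n : ℕ} (pA : (Fin n → ℝ) →₀ ℝ≥0) (P Q : (Fin n → ℝ) → Measure ℝ)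
    (lam : ℝ) : ℝ≥0∞ :=
  ∏ a ∈ pA.support, affinity (P a) (Q a) lam ^ (pA a : ℝ)

theorem log_prod_rpow {ι : Type*} (t : Finset ι) (f : ι → ℝ≥0∞) (p : ι → ℝ) :
    ENNReal.log (∏ a ∈ t, f a ^ p a) = ∑ a ∈ t, ((p a : ℝ) : EReal) * ENNReal.log (f a) := by
  classical
  induction t using Finset.induction_on with
  | empty => simp
  | insert a t ha ih =>
    rw [Finset.prod_insert ha, Finset.sum_insert ha, ENNReal.log_mul_add, ih, ENNReal.log_rpow]

theorem outerChernoff_eq {n : ℕ} (pA : (Fin n → ℝ) →₀ ℝ≥0) (P Q : (Fin n → ℝ) → Measure ℝ) :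
    outerChernoff pA P Q =
      -⨅ lam ∈ Set.Icc (0 : ℝ) 1, ENNReal.log (meanAffinity pA P Q lam) := by
  simp only [outerChernoff, meanAffinity, log_prod_rpow, Finsupp.sum]

/-- The affinity of product laws is the product of the affinities. -/
theorem lintegral_geom_pi {m : ℕ} {P Q : Fin m → Measure ℝ} [∀ j, IsProbabilityMeasure (P j)]
    [∀ j, IsProbabilityMeasure (Q j)] {lam : ℝ} (hlam : lam ∈ Set.Icc (0 : ℝ) 1) :
    ∫⁻ y, (Measure.pi P).rnDeriv (Measure.pi P + Measure.pi Q) y ^ lam *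
        (Measure.pi Q).rnDeriv (Measure.pi P + Measure.pi Q) y ^ (1 - lam)
        ∂(Measure.pi P + Measure.pi Q) =
      ∏ j, affinity (P j) (Q j) lam := by
  have hPd : ∀ j, (P j + Q j).withDensity ((P j).rnDeriv (P j + Q j)) = P j := fun j =>
    Measure.withDensity_rnDeriv_eq _ _ (Measure.AbsolutelyContinuous.rfl.add_right _)
  have hQd : ∀ j, (P j + Q j).withDensity ((Q j).rnDeriv (P j + Q j)) = Q j := fun j =>
    Measure.withDensity_rnDeriv_eq _ _ (Measure.absolutelyContinuous_of_le
      (Measure.le_add_left le_rfl))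
  have hi : ∀ j, SigmaFinite ((P j + Q j).withDensity ((P j).rnDeriv (P j + Q j))) :=
    fun j => by rw [hPd]; infer_instance
  have hi' : ∀ j, SigmaFinite ((P j + Q j).withDensity ((Q j).rnDeriv (P j + Q j))) :=
    fun j => by rw [hQd]; infer_instance
  have h1 := pi_withDensity_eq (fun j => P j + Q j)
    (fun j => Measure.measurable_rnDeriv (P j) (P j + Q j))
  have h2 := pi_withDensity_eq (fun j => P j + Q j)
    (fun j => Measure.measurable_rnDeriv (Q j) (P j + Q j))
  simp only [hPd] at h1
  simp only [hQd] at h2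
  rw [lintegral_geom_withDensity
    (Finset.measurable_prod _ fun j _ =>
      (Measure.measurable_rnDeriv (P j) (P j + Q j)).comp (measurable_pi_apply j))
    (Finset.measurable_prod _ fun j _ =>
      (Measure.measurable_rnDeriv (Q j) (P j + Q j)).comp (measurable_pi_apply j)) h1 h2 hlam]
  have hl' : 0 ≤ 1 - lam := by linarith [hlam.2]
  simp only [← ENNReal.prod_rpow_of_nonneg hlam.1, ← ENNReal.prod_rpow_of_nonneg hl',
    ← Finset.prod_mul_distrib]
  exact lintegral_pi_prod (fun j => P j + Q j)
    (f := fun j => geomDensity (P j) (Q j) lam) fun j => by unfold geomDensity; fun_prop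

section LikelihoodRatio

variable {n m k : ℕ} (f₁ f₂ : Measure ℝ) (s : Fin m → Fin n → ℝ)

theorem isFiniteMeasure_sum_dataLaw [IsProbabilityMeasure f₁] [IsProbabilityMeasure f₂] :
    IsFiniteMeasure (∑ v : Hypothesis n k, dataLaw f₁ f₂ s v.1) := by
  infer_instance

theorem dataLaw_absolutelyContinuous_sum (v : Hypothesis n k) :
    dataLaw f₁ f₂ s v.1 ≪ ∑ v : Hypothesis n k, dataLaw f₁ f₂ s v.1 :=
  Measure.absolutelyContinuous_of_le
    (Finset.single_le_sum (f := fun v : Hypothesis n k => dataLaw f₁ f₂ s v.1)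
      (fun _ _ => Measure.zero_le _) (Finset.mem_univ v))

theorem withDensity_likelihood [IsProbabilityMeasure f₁] [IsProbabilityMeasure f₂]
    (v : Hypothesis n k) :
    (∑ v : Hypothesis n k, dataLaw f₁ f₂ s v.1).withDensity (likelihood k f₁ f₂ s v.1) =
      dataLaw f₁ f₂ s v.1 :=
  have := isFiniteMeasure_sum_dataLaw (k := k) f₁ f₂ s
  have := Measure.haveLebesgueDecomposition_of_sigmaFinite (dataLaw f₁ f₂ s v.1)
    (∑ v : Hypothesis n k, dataLaw f₁ f₂ s v.1)
  Measure.withDensity_rnDeriv_eq _ _ (dataLaw_absolutelyContinuous_sum f₁ f₂ s v)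

theorem measurable_likelihood (K : Finset (Fin n)) : Measurable (likelihood k f₁ f₂ s K) :=
  Measure.measurable_rnDeriv _ _

/-- The probability that a wrong hypothesis is at least as likely as the true one. -/
theorem dataLaw_likelihood_le [IsProbabilityMeasure f₁] [IsProbabilityMeasure f₂]
    {pA : (Fin n → ℝ) →₀ ℝ≥0} (hs : IsSchedule pA s)
    (v w : Hypothesis n k) {lam : ℝ} (hlam : lam ∈ Set.Icc (0 : ℝ) 1) :
    dataLaw f₁ f₂ s v.1 {y | likelihood k f₁ f₂ s v.1 y ≤ likelihood k f₁ f₂ s w.1 y} ≤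
      meanAffinity pA (obsLaw f₁ f₂ v.1) (obsLaw f₁ f₂ w.1) lam ^ m := by
  set μ := ∑ v : Hypothesis n k, dataLaw f₁ f₂ s v.1
  set A := {y | likelihood k f₁ f₂ s v.1 y ≤ likelihood k f₁ f₂ s w.1 y}
  have hl' : 0 ≤ 1 - lam := by linarith [hlam.2]
  have hA : MeasurableSet A :=
    measurableSet_le (measurable_likelihood f₁ f₂ s _) (measurable_likelihood f₁ f₂ s _)
  calc dataLaw f₁ f₂ s v.1 A = ∫⁻ y in A, likelihood k f₁ f₂ s v.1 y ∂μ := by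
        rw [← withDensity_apply _ hA, withDensity_likelihood]
    _ ≤ ∫⁻ y in A, likelihood k f₁ f₂ s v.1 y ^ lam *
          likelihood k f₁ f₂ s w.1 y ^ (1 - lam) ∂μ := by
        refine setLIntegral_mono' hA fun y hy => ?_
        calc _ = likelihood k f₁ f₂ s v.1 y ^ lam * likelihood k f₁ f₂ s v.1 y ^ (1 - lam) := by
              rw [← ENNReal.rpow_add_of_nonneg _ _ hlam.1 hl']; simp
          _ ≤ _ := by
              gcongr
              exact hy
    _ ≤ ∫⁻ y, likelihood k f₁ f₂ s v.1 y ^ lam *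
          likelihood k f₁ f₂ s w.1 y ^ (1 - lam) ∂μ := setLIntegral_le_lintegral _ _
    _ = ∏ j, affinity (obsLaw f₁ f₂ v.1 (s j)) (obsLaw f₁ f₂ w.1 (s j)) lam := by
        rw [← lintegral_geom_withDensity (measurable_likelihood f₁ f₂ s _)
          (measurable_likelihood f₁ f₂ s _) (withDensity_likelihood f₁ f₂ s v).symm
          (withDensity_likelihood f₁ f₂ s w).symm hlam]
        exact lintegral_geom_pi hlam
    _ = _ := hs.prod_ennreal fun a => affinity (obsLaw f₁ f₂ v.1 a) (obsLaw f₁ f₂ w.1 a) lam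

theorem IsLikelihoodRatioTest.errorProb_le {f₁ f₂ : Measure ℝ} [IsProbabilityMeasure f₁]
    [IsProbabilityMeasure f₂] {s : Fin m → Fin n → ℝ} {φ : DecisionRule n m}
    (hφ : IsLikelihoodRatioTest k f₁ f₂ s φ) {pA : (Fin n → ℝ) →₀ ℝ≥0} (hs : IsSchedule pA s)
    (v : Hypothesis n k) {lam : Hypothesis n k → ℝ} (hlam : ∀ w, lam w ∈ Set.Icc (0 : ℝ) 1) :
    errorProb f₁ f₂ s φ v.1 ≤ ∑ w ∈ Finset.univ.erase v,
      meanAffinity pA (obsLaw f₁ f₂ v.1) (obsLaw f₁ f₂ w.1) (lam w) ^ m := by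
  classical
  calc errorProb f₁ f₂ s φ v.1
      ≤ dataLaw f₁ f₂ s v.1 (⋃ w ∈ Finset.univ.erase v,
          {y | likelihood k f₁ f₂ s v.1 y ≤ likelihood k f₁ f₂ s w.1 y}) := by
        refine measure_mono_ae ?_
        filter_upwards [(dataLaw_absolutelyContinuous_sum f₁ f₂ s v).ae_le hφ] with y hy hne
        obtain ⟨w, hw, hmax⟩ := hy
        refine Set.mem_biUnion (x := w) ?_ (hmax v)
        simp only [Finset.coe_erase, Finset.coe_univ, Set.mem_sdiff, Set.mem_univ, true_and,
          Set.mem_singleton_iff]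
        rintro rfl
        exact hne hw
    _ ≤ ∑ w ∈ Finset.univ.erase v, dataLaw f₁ f₂ s v.1
          {y | likelihood k f₁ f₂ s v.1 y ≤ likelihood k f₁ f₂ s w.1 y} :=
        measure_biUnion_finset_le _ _
    _ ≤ _ := Finset.sum_le_sum fun w _ => dataLaw_likelihood_le f₁ f₂ s hs v w (hlam w)

theorem exists_isLikelihoodRatioTest [Nonempty (Hypothesis n k)] :
    ∃ φ : DecisionRule n m, IsLikelihoodRatioTest k f₁ f₂ s φ := by
  classical
  set B : (Fin m → ℝ) → Finset (Hypothesis n k) := fun y =>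
    Finset.univ.filter fun v => ∀ w : Hypothesis n k,
      likelihood k f₁ f₂ s w.1 y ≤ likelihood k f₁ f₂ s v.1 y with hB
  set g : Finset (Hypothesis n k) → Finset (Fin n) := fun T =>
    if h : T.Nonempty then h.choose.1 else ∅ with hg
  have hBm : ∀ T, MeasurableSet (B ⁻¹' {T}) := by
    intro T
    have : B ⁻¹' {T} = ⋂ v, {y | (∀ w : Hypothesis n k,
        likelihood k f₁ f₂ s w.1 y ≤ likelihood k f₁ f₂ s v.1 y) ↔ v ∈ T} := by
      ext y
      simp [hB, Finset.ext_iff]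
    rw [this]
    refine MeasurableSet.iInter fun v => ?_
    refine MeasurableSet.iff ?_ (MeasurableSet.const _)
    rw [Set.ofPred_forall]
    exact MeasurableSet.iInter fun w => measurableSet_le (measurable_likelihood f₁ f₂ s _)
      (measurable_likelihood f₁ f₂ s _)
  refine ⟨⟨g ∘ B, fun K => ?_⟩, Eventually.of_forall fun y => ?_⟩
  · rw [Set.preimage_comp, ← Set.biUnion_preimage_singleton]
    exact MeasurableSet.biUnion (Set.to_countable _) fun T _ => hBm T
  · have hne : (B y).Nonempty := by
      obtain ⟨v, -, hv⟩ := Finset.exists_max_image Finset.univ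
        (fun v : Hypothesis n k => likelihood k f₁ f₂ s v.1 y) Finset.univ_nonempty
      exact ⟨v, by simpa [hB] using hv⟩
    refine ⟨hne.choose, ?_, ?_⟩
    · simp [hg, hne]
    · have := hne.choose_spec
      simpa [hB] using this

end LikelihoodRatio

section MomentGenerating

variable {N : Measure ℝ} [IsFiniteMeasure N] {l : ℝ → ℝ}

theorem integrable_exp_mul_of_mem_Icc (h : Integrable (fun y => Real.exp (l y)) N) {lam : ℝ}
    (hlam : lam ∈ Set.Icc (0 : ℝ) 1) : Integrable (fun y => Real.exp (lam * l y)) N :=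
  ProbabilityTheory.integrable_exp_mul_of_nonneg_of_le (u := 1) (by simpa using h) hlam.1 hlam.2

theorem Ioo_subset_interior_integrableExpSet (h : Integrable (fun y => Real.exp (l y)) N) :
    Set.Ioo (0 : ℝ) 1 ⊆ interior (ProbabilityTheory.integrableExpSet l N) :=
  interior_maximal (fun _ ht => integrable_exp_mul_of_mem_Icc h (Set.Ioo_subset_Icc_self ht))
    isOpen_Ioo

theorem exp_mul_le_of_mem_Icc (x : ℝ) {lam : ℝ} (hlam : lam ∈ Set.Icc (0 : ℝ) 1) :
    Real.exp (lam * x) ≤ lam * Real.exp x + (1 - lam) := by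
  have := convexOn_exp.2 (Set.mem_univ x) (Set.mem_univ 0) hlam.1
    (by linarith [hlam.2] : 0 ≤ 1 - lam) (by ring)
  simpa using this

theorem continuousOn_mgf_Icc (hl : Measurable l) (h : Integrable (fun y => Real.exp (l y)) N) :
    ContinuousOn (ProbabilityTheory.mgf l N) (Set.Icc 0 1) := by
  refine continuousOn_of_dominated (bound := fun y => Real.exp (l y) + 1)
    (fun lam _ => by fun_prop) (fun lam hlam => ae_of_all _ fun y => ?_)
    (h.add (integrable_const 1)) (ae_of_all _ fun y => by fun_prop)
  rw [Real.norm_of_nonneg (Real.exp_pos _).le]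
  have h1 := exp_mul_le_of_mem_Icc (l y) hlam
  nlinarith [hlam.1, hlam.2, Real.exp_pos (l y)]

theorem lintegral_exp_mul_eq (h : Integrable (fun y => Real.exp (l y)) N) {lam : ℝ}
    (hlam : lam ∈ Set.Icc (0 : ℝ) 1) :
    ∫⁻ y, ENNReal.ofReal (Real.exp (lam * l y)) ∂N =
      ENNReal.ofReal (ProbabilityTheory.mgf l N lam) :=
  (ofReal_integral_eq_lintegral_ofReal (integrable_exp_mul_of_mem_Icc h hlam)
    (ae_of_all _ fun _ => (Real.exp_pos _).le)).symm

end MomentGenerating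

/-- Every test between two product laws has a total error probability that is bounded from below
by means of the exponentially tilted law, provided that the log-likelihood ratios are bounded on
the considered sets. -/
theorem testing_lower_bound {m : ℕ} (hm : 0 < m) {P Q : Fin m → Measure ℝ}
    [∀ j, IsProbabilityMeasure (P j)] [∀ j, IsProbabilityMeasure (Q j)]
    {A : Fin m → Set ℝ} (hA : ∀ j, MeasurableSet (A j)) {l : Fin m → ℝ → ℝ}
    (hl : ∀ j, Measurable (l j))
    (hPQ : ∀ j, (P j).restrict (A j) =
      ((Q j).restrict (A j)).withDensity fun y => ENNReal.ofReal (Real.exp (l j y)))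
    {B : ℝ} (hB : 0 < B) (hlB : ∀ j, ∀ y ∈ A j, |l j y| ≤ B) (hQA : ∀ j, Q j (A j) ≠ 0)
    {lam : ℝ} (hlam : lam ∈ Set.Icc (0 : ℝ) 1)
    (h1 : 0 ≤ (1 - lam) *
      ∑ j, ∫ y, l j y ∂(((Q j).restrict (A j)).tilted fun y => lam * l j y))
    (h2 : lam * ∑ j, ∫ y, l j y ∂(((Q j).restrict (A j)).tilted fun y => lam * l j y) ≤ 0)
    {F : Set (Fin m → ℝ)} (hF : MeasurableSet F) :
    2⁻¹ ≤ ENNReal.ofReal (Real.exp (2 * B * √m) /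
        ∏ j, ProbabilityTheory.mgf (l j) ((Q j).restrict (A j)) lam) *
      (Measure.pi P F + Measure.pi Q Fᶜ) := by
  set N : Fin m → Measure ℝ := fun j => (Q j).restrict (A j) with hN
  set T : Fin m → Measure ℝ := fun j => (N j).tilted fun y => lam * l j y with hT
  set μ : ℝ := ∑ j, ∫ y, l j y ∂(T j) with hμ
  set Z : Fin m → ℝ := fun j => ProbabilityTheory.mgf (l j) (N j) lam with hZ
  set c : ℝ := 2 * B * √m with hc
  set L : (Fin m → ℝ) → ℝ := fun y => ∑ j, l j (y j) with hL
  have hcpos : 0 < c := by positivity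
  have hNB : ∀ j, ∀ᵐ y ∂(N j), |l j y| ≤ B := fun j => by
    filter_upwards [ae_restrict_mem (hA j)] with y hy using hlB j y hy
  have hNe : ∀ j, NeZero (N j) := fun j => ⟨by
    simpa [hN, Measure.restrict_eq_zero] using hQA j⟩
  have hint : ∀ j, Integrable (fun y => Real.exp (lam * l j y)) (N j) := fun j => by
    refine Integrable.of_bound (by have := hl j; fun_prop) (Real.exp B) ?_
    filter_upwards [hNB j] with y hy
    rw [Real.norm_of_nonneg (Real.exp_pos _).le, Real.exp_le_exp]
    calc lam * l j y ≤ |lam * l j y| := le_abs_self _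
      _ = lam * |l j y| := by rw [abs_mul, abs_of_nonneg hlam.1]
      _ ≤ 1 * B := mul_le_mul hlam.2 hy (abs_nonneg _) zero_le_one
      _ = B := one_mul B
  have hTp : ∀ j, IsProbabilityMeasure (T j) := fun j => isProbabilityMeasure_tilted (hint j)
  have hTB : ∀ j, ∀ᵐ y ∂(T j), |l j y| ≤ B := fun j =>
    (tilted_absolutelyContinuous _ _).ae_le (hNB j)
  have hZpos : ∀ j, 0 < Z j := fun j => integral_exp_pos (hint j)
  have hK : 0 < ∏ j, Z j := Finset.prod_pos fun j _ => hZpos j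
  have hLm : Measurable L := Finset.measurable_sum _ fun j _ => (hl j).comp (measurable_pi_apply j)
  have hmem : ∀ j, MemLp (l j) 2 (T j) := fun j =>
    MemLp.of_bound (hl j).aestronglyMeasurable B (by simpa [Real.norm_eq_abs] using hTB j)
  have hmemL : MemLp L 2 (Measure.pi T) := memLp_finsetSum _ fun j _ =>
    (hmem j).comp_measurePreserving (measurePreserving_eval _ j)
  have hmean : ∫ y, L y ∂(Measure.pi T) = μ := by
    rw [integral_finsetSum _ fun j _ =>
      integrable_comp_eval ((hmem j).integrable (by norm_num))]
    refine Finset.sum_congr rfl fun j _ => ?_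
    exact integral_comp_eval (μ := T) (i := j) (f := l j) (hl j).aestronglyMeasurable
  have hvar : ProbabilityTheory.variance L (Measure.pi T) ≤ m * B ^ 2 := by
    have hLe : L = ∑ j, fun y : Fin m → ℝ => l j (y j) := by
      funext y; simp [hL]
    rw [hLe, ProbabilityTheory.variance_sum_pi hmem]
    calc _ ≤ ∑ _j : Fin m, B ^ 2 := Finset.sum_le_sum fun j _ => by
          refine (ProbabilityTheory.variance_le_sq_of_bounded (a := -B) (b := B) ?_
            (hl j).aemeasurable).trans (le_of_eq (by ring))
          filter_upwards [hTB j] with y hy using abs_le.1 hy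
      _ = _ := by simp
  set G : Set (Fin m → ℝ) := {y | |L y - μ| < c} with hG
  have hGm : MeasurableSet G := measurableSet_lt (by fun_prop) measurable_const
  have hGc : Measure.pi T Gᶜ ≤ 2⁻¹ := by
    have h := ProbabilityTheory.meas_ge_le_variance_div_sq hmemL hcpos
    rw [hmean] at h
    have hset : Gᶜ = {y | c ≤ |L y - μ|} := by ext y; simp [hG]
    rw [hset]
    refine h.trans ?_
    have hc2 : c ^ 2 = 4 * (m * B ^ 2) := by
      rw [hc, mul_pow, mul_pow, Real.sq_sqrt (Nat.cast_nonneg m)]; ring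
    have hmB : 0 < (m : ℝ) * B ^ 2 := by positivity
    have : ProbabilityTheory.variance L (Measure.pi T) / c ^ 2 ≤ 2⁻¹ := by
      rw [hc2, div_le_iff₀ (by positivity)]
      linarith
    calc _ ≤ ENNReal.ofReal 2⁻¹ := ENNReal.ofReal_le_ofReal this
      _ = 2⁻¹ := by rw [ENNReal.ofReal_inv_of_pos (by norm_num)]; simp
  have hG1 : 2⁻¹ ≤ Measure.pi T G := by
    have h : Measure.pi T G + Measure.pi T Gᶜ = 1 := prob_add_prob_compl hGm
    by_contra hlt
    push Not at hlt
    have h' : Measure.pi T G + Measure.pi T Gᶜ < 2⁻¹ + 2⁻¹ :=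
      ENNReal.add_lt_add_of_lt_of_le (ne_top_of_le_ne_top (by simp) hGc) hlt hGc
    rw [h, ENNReal.inv_two_add_inv_two] at h'
    exact lt_irrefl _ h'
  set C : ℝ≥0∞ := ENNReal.ofReal (Real.exp c / ∏ j, Z j) with hC
  have hTd : Measure.pi T = (Measure.pi N).withDensity fun y =>
      ∏ j, ENNReal.ofReal (Real.exp (lam * l j (y j)) / Z j) := by
    have hfin : ∀ j, SigmaFinite ((N j).withDensity fun y =>
        ENNReal.ofReal (Real.exp (lam * l j y) / Z j)) := fun j => by
      change SigmaFinite (T j); infer_instance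
    exact pi_withDensity_eq N (f := fun j y => ENNReal.ofReal (Real.exp (lam * l j y) / Z j))
      fun j => by have := hl j; fun_prop
  have hprod : ∀ y : Fin m → ℝ, ∏ j, ENNReal.ofReal (Real.exp (lam * l j (y j)) / Z j) =
      ENNReal.ofReal (Real.exp (lam * L y) / ∏ j, Z j) := fun y => by
    rw [← ENNReal.ofReal_prod_of_nonneg fun j _ => by
      have := (hZpos j).le; positivity, Finset.prod_div_distrib, ← Real.exp_sum,
      ← Finset.mul_sum]
  have hPd : Measure.pi (fun j => (P j).restrict (A j)) =
      (Measure.pi N).withDensity fun y => ENNReal.ofReal (Real.exp (L y)) := by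
    have hfin : ∀ j, SigmaFinite ((N j).withDensity fun y =>
        ENNReal.ofReal (Real.exp (l j y))) := fun j => by
      rw [hN, ← hPQ]; infer_instance
    have h := pi_withDensity_eq N (f := fun j y => ENNReal.ofReal (Real.exp (l j y)))
      fun j => by have := hl j; fun_prop
    simp only [hPQ]
    rw [h]
    congr 1
    funext y
    rw [← ENNReal.ofReal_prod_of_nonneg fun j _ => (Real.exp_pos _).le, ← Real.exp_sum]
  have hQle : Measure.pi N ≤ Measure.pi Q := by
    rw [hN, ← Measure.restrict_pi_pi]; exact Measure.restrict_le_self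
  have hPle : Measure.pi (fun j => (P j).restrict (A j)) ≤ Measure.pi P := by
    rw [← Measure.restrict_pi_pi]; exact Measure.restrict_le_self
  have hQG : Measure.pi T (Fᶜ ∩ G) ≤ C * Measure.pi Q Fᶜ := by
    rw [hTd, withDensity_apply _ (hF.compl.inter hGm)]
    calc _ ≤ ∫⁻ _ in Fᶜ ∩ G, C ∂(Measure.pi N) := by
          refine setLIntegral_mono' (hF.compl.inter hGm) fun y hy => ?_
          rw [hprod]
          refine ENNReal.ofReal_le_ofReal (div_le_div_of_nonneg_right ?_ hK.le)
          rw [Real.exp_le_exp]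
          have hyG : |L y - μ| < c := hy.2
          have := (abs_lt.1 hyG).2
          nlinarith [hlam.1, hlam.2]
      _ = C * Measure.pi N (Fᶜ ∩ G) := setLIntegral_const _ _
      _ ≤ _ := by
          exact mul_le_mul' le_rfl ((hQle _).trans (measure_mono Set.inter_subset_left))
  have hPG : Measure.pi T (F ∩ G) ≤ C * Measure.pi P F := by
    rw [hTd, withDensity_apply _ (hF.inter hGm)]
    calc _ ≤ ∫⁻ y in F ∩ G, C * ENNReal.ofReal (Real.exp (L y)) ∂(Measure.pi N) := by
          refine setLIntegral_mono' (hF.inter hGm) fun y hy => ?_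
          rw [hprod, hC, ← ENNReal.ofReal_mul (by positivity), div_mul_eq_mul_div,
            ← Real.exp_add]
          refine ENNReal.ofReal_le_ofReal (div_le_div_of_nonneg_right ?_ hK.le)
          rw [Real.exp_le_exp]
          have hyG : |L y - μ| < c := hy.2
          have := (abs_lt.1 hyG).1
          nlinarith [hlam.1, hlam.2]
      _ = C * Measure.pi (fun j => (P j).restrict (A j)) (F ∩ G) := by
          rw [lintegral_const_mul _ (by fun_prop), hPd, withDensity_apply _ (hF.inter hGm)]
      _ ≤ _ := by
          exact mul_le_mul' le_rfl ((hPle _).trans (measure_mono Set.inter_subset_left))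
  calc 2⁻¹ ≤ Measure.pi T G := hG1
    _ = Measure.pi T (F ∩ G) + Measure.pi T (Fᶜ ∩ G) := by
        rw [Set.inter_comm, Set.inter_comm Fᶜ, ← Set.sdiff_eq, measure_inter_add_sdiff _ hF]
    _ ≤ C * Measure.pi P F + C * Measure.pi Q Fᶜ := add_le_add hPG hQG
    _ = _ := (mul_add _ _ _).symm

/-- A lower bound for the weighted geometric mean of the moment generating functions on `[0, 1]`
is retained if the log-likelihood ratios are truncated at a large level. -/
theorem exists_truncation {ι : Type*} (t : Finset ι) {p : ι → ℝ} (hp : ∀ a, 0 ≤ p a)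
    {N : ι → Measure ℝ} [∀ a, IsFiniteMeasure (N a)] {l : ι → ℝ → ℝ} (hl : ∀ a, Measurable (l a))
    (hint : ∀ a, Integrable (fun y => Real.exp (l a y)) (N a)) {K K₀ : ℝ} (hK : K < K₀)
    (h : ∀ lam ∈ Set.Icc (0 : ℝ) 1, K₀ ≤ ∏ a ∈ t, ProbabilityTheory.mgf (l a) (N a) lam ^ p a) :
    ∃ B : ℝ, 0 < B ∧ ∀ lam ∈ Set.Icc (0 : ℝ) 1, K < ∏ a ∈ t,
      ProbabilityTheory.mgf (l a) ((N a).restrict {y | |l a y| ≤ B}) lam ^ p a := by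
  set A : ι → ℕ → Set ℝ := fun a b => {y | |l a y| ≤ b} with hA
  have hAm : ∀ a b, MeasurableSet (A a b) := fun a b =>
    measurableSet_le (by have := hl a; fun_prop) measurable_const
  have hAmono : ∀ a, Monotone (A a) := fun a b b' hb y hy =>
    le_trans (show |l a y| ≤ b from hy) (by exact_mod_cast hb)
  have hAU : ∀ a, ⋃ b, A a b = Set.univ := fun a => Set.eq_univ_of_forall fun y => by
    obtain ⟨b, hb⟩ := exists_nat_ge |l a y|
    exact Set.mem_iUnion.2 ⟨b, hb⟩
  have hmono : ∀ lam ∈ Set.Icc (0 : ℝ) 1, ∀ a, Monotone fun b =>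
      ProbabilityTheory.mgf (l a) ((N a).restrict (A a b)) lam := fun lam hlam a b b' hb =>
    setIntegral_mono_set (integrable_exp_mul_of_mem_Icc (hint a) hlam).integrableOn
      (ae_of_all _ fun _ => (Real.exp_pos _).le) (LE.le.eventuallyLE (hAmono a hb))
  have hdini := Monotone.tendstoUniformlyOn_of_forall_tendsto (s := Set.Icc (0 : ℝ) 1)
    (F := fun (b : ℕ) lam => ∏ a ∈ t, ProbabilityTheory.mgf (l a) ((N a).restrict (A a b)) lam ^ p a)
    (f := fun lam => ∏ a ∈ t, ProbabilityTheory.mgf (l a) (N a) lam ^ p a) isCompact_Icc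
    (fun b => continuousOn_finsetProd _ fun a _ =>
      (continuousOn_mgf_Icc (hl a) (hint a).integrableOn).rpow_const fun _ _ => Or.inr (hp a))
    (fun lam hlam b b' hb => Finset.prod_le_prod
      (fun a _ => Real.rpow_nonneg ProbabilityTheory.mgf_nonneg _)
      fun a _ => Real.rpow_le_rpow ProbabilityTheory.mgf_nonneg (hmono lam hlam a hb) (hp a))
    (continuousOn_finsetProd _ fun a _ =>
      (continuousOn_mgf_Icc (hl a) (hint a)).rpow_const fun _ _ => Or.inr (hp a))
    (fun lam hlam => tendsto_finsetProd _ fun a _ => by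
      refine Tendsto.rpow_const ?_ (Or.inr (hp a))
      have := tendsto_setIntegral_of_monotone (hAm a) (hAmono a)
        (integrable_exp_mul_of_mem_Icc (hint a) hlam).integrableOn
      rwa [hAU, setIntegral_univ] at this)
  have hev := Metric.tendstoUniformlyOn_iff.1 hdini (K₀ - K) (by linarith)
  obtain ⟨b, hb, hb0⟩ := (hev.and (eventually_gt_atTop 0)).exists
  refine ⟨b, by exact_mod_cast hb0, fun lam hlam => ?_⟩
  have h1 := hb lam hlam
  rw [Real.dist_eq] at h1
  linarith [h lam hlam, (abs_lt.1 h1).2]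

namespace IsCommonPart

variable {P Q : Measure ℝ} {S : Set ℝ} {l : ℝ → ℝ}

theorem integrable_exp [IsFiniteMeasure P] (h : IsCommonPart P Q S l) :
    Integrable (fun y => Real.exp (l y)) (Q.restrict S) := by
  have hl := h.measurable
  refine ⟨by fun_prop, ?_⟩
  rw [hasFiniteIntegral_iff_ofReal (ae_of_all _ fun _ => (Real.exp_pos _).le),
    ← setLIntegral_univ, ← withDensity_apply _ MeasurableSet.univ, ← h.restrict_eq]
  exact measure_lt_top _ _

/-- The affinity as a moment generating function of the log-likelihood ratio. -/
theorem affinity_eq_mgf [IsFiniteMeasure P] [IsFiniteMeasure Q] (h : IsCommonPart P Q S l)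
    {lam : ℝ} (hlam : lam ∈ Set.Ioo (0 : ℝ) 1) :
    affinity P Q lam = ENNReal.ofReal (ProbabilityTheory.mgf l (Q.restrict S) lam) := by
  have h' := congrArg (fun μ : Measure ℝ => μ Set.univ) (h.withDensity_geom lam hlam)
  simp only [withDensity_apply _ MeasurableSet.univ, Measure.restrict_univ] at h'
  rw [← lintegral_exp_mul_eq h.integrable_exp (Set.Ioo_subset_Icc_self hlam), ← h']
  rfl

end IsCommonPart

/-- At a minimizer `x` over `[0, 1]` of a differentiable function, the derivative satisfies the
first order conditions. -/
theorem first_order_conditions {G : ℝ → ℝ} {x d : ℝ} (hx : x ∈ Set.Icc (0 : ℝ) 1)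
    (hmin : IsMinOn G (Set.Icc 0 1) x) (hd : HasDerivAt G d x) :
    0 ≤ (1 - x) * d ∧ x * d ≤ 0 := by
  have hF := hd.hasFDerivAt.hasFDerivWithinAt (s := Set.Icc (0 : ℝ) 1)
  have hseg : ∀ y ∈ Set.Icc (0 : ℝ) 1, y - x ∈ posTangentConeAt (Set.Icc (0 : ℝ) 1) x :=
    fun y hy => sub_mem_posTangentConeAt_of_segment_subset
      ((convex_Icc (0 : ℝ) 1).segment_subset hx hy)
  have h1 := hmin.localize.hasFDerivWithinAt_nonneg hF (hseg 1 (by simp))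
  have h0 := hmin.localize.hasFDerivWithinAt_nonneg hF (hseg 0 (by simp))
  simp at h1 h0
  exact ⟨h1, h0⟩

/-- The converse for two hypotheses: a lower bound for the total error probability of every test
along a schedule. -/
theorem exists_schedule_lower_bound {n : ℕ} {pA : (Fin n → ℝ) →₀ ℝ≥0}
    (P Q : (Fin n → ℝ) → Measure ℝ)
    [∀ a, IsProbabilityMeasure (P a)] [∀ a, IsProbabilityMeasure (Q a)] {K K₀ : ℝ} (hK : 0 < K)
    (hKK : K < K₀)
    (h : ∀ lam ∈ Set.Ioo (0 : ℝ) 1, ENNReal.ofReal K₀ ≤ meanAffinity pA P Q lam) :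
    ∃ B : ℝ, 0 < B ∧ ∀ m : ℕ, 0 < m → ∀ s : Fin m → Fin n → ℝ, IsSchedule pA s →
      ∀ F : Set (Fin m → ℝ), MeasurableSet F →
        2⁻¹ ≤ ENNReal.ofReal (Real.exp (2 * B * √m) / K ^ m) *
          (Measure.pi (fun j => P (s j)) F + Measure.pi (fun j => Q (s j)) Fᶜ) := by
  choose S l hSl using fun a => exists_isCommonPart (P a) (Q a)
  have hS := fun a => (hSl a).measurableSet
  have hl := fun a => (hSl a).measurable
  have hPQ := fun a => (hSl a).restrict_eq
  have hint : ∀ a, Integrable (fun y => Real.exp (l a y)) ((Q a).restrict (S a)) := fun a =>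
    (hSl a).integrable_exp
  have hIoo : ∀ lam ∈ Set.Ioo (0 : ℝ) 1, K₀ ≤ ∏ a ∈ pA.support,
      ProbabilityTheory.mgf (l a) ((Q a).restrict (S a)) lam ^ (pA a : ℝ) := by
    intro lam hlam
    have h' := h lam hlam
    have hnn : ∀ a ∈ pA.support, 0 ≤
        ProbabilityTheory.mgf (l a) ((Q a).restrict (S a)) lam ^ (pA a : ℝ) :=
      fun a _ => Real.rpow_nonneg ProbabilityTheory.mgf_nonneg _
    have heq : meanAffinity pA P Q lam = ENNReal.ofReal (∏ a ∈ pA.support,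
        ProbabilityTheory.mgf (l a) ((Q a).restrict (S a)) lam ^ (pA a : ℝ)) := by
      rw [ENNReal.ofReal_prod_of_nonneg hnn]
      refine Finset.prod_congr rfl fun a _ => ?_
      rw [(hSl a).affinity_eq_mgf hlam,
        ENNReal.ofReal_rpow_of_nonneg ProbabilityTheory.mgf_nonneg (pA a).coe_nonneg]
    rw [heq] at h'
    exact (ENNReal.ofReal_le_ofReal_iff (Finset.prod_nonneg hnn)).1 h'
  have hIcc : ∀ lam ∈ Set.Icc (0 : ℝ) 1, K₀ ≤ ∏ a ∈ pA.support,
      ProbabilityTheory.mgf (l a) ((Q a).restrict (S a)) lam ^ (pA a : ℝ) := by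
    intro lam hlam
    have hc : ContinuousOn (fun lam => ∏ a ∈ pA.support,
        ProbabilityTheory.mgf (l a) ((Q a).restrict (S a)) lam ^ (pA a : ℝ)) (Set.Icc 0 1) :=
      continuousOn_finsetProd _ fun a _ =>
        (continuousOn_mgf_Icc (hl a) (hint a)).rpow_const fun _ _ => Or.inr (pA a).coe_nonneg
    refine ContinuousWithinAt.closure_le (s := Set.Ioo (0 : ℝ) 1) ?_ continuousWithinAt_const
      ((hc lam hlam).mono Set.Ioo_subset_Icc_self) hIoo
    rwa [closure_Ioo zero_ne_one]
  obtain ⟨B, hB, hBK⟩ := exists_truncation pA.support (p := fun a => (pA a : ℝ))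
    (fun a => (pA a).coe_nonneg) hl hint hKK hIcc
  set A : (Fin n → ℝ) → Set ℝ := fun a => {y | |l a y| ≤ B} ∩ S a with hA
  have hBm : ∀ a, MeasurableSet {y | |l a y| ≤ B} := fun a =>
    measurableSet_le (by have := hl a; fun_prop) measurable_const
  have hAm : ∀ a, MeasurableSet (A a) := fun a => (hBm a).inter (hS a)
  simp only [Measure.restrict_restrict (hBm _)] at hBK
  set N : (Fin n → ℝ) → Measure ℝ := fun a => (Q a).restrict (A a) with hN
  have hNint : ∀ a (t : ℝ), Integrable (fun y => Real.exp (t * l a y)) (N a) := fun a t => by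
    refine Integrable.of_bound (by have := hl a; fun_prop) (Real.exp (|t| * B)) ?_
    filter_upwards [ae_restrict_mem (hAm a)] with y hy
    rw [Real.norm_of_nonneg (Real.exp_pos _).le, Real.exp_le_exp]
    calc _ ≤ |t * l a y| := le_abs_self _
      _ = |t| * |l a y| := abs_mul _ _
      _ ≤ _ := mul_le_mul_of_nonneg_left hy.1 (abs_nonneg t)
  have hset : ∀ a, ProbabilityTheory.integrableExpSet (l a) (N a) = Set.univ := fun a =>
    Set.eq_univ_of_forall (hNint a)
  have hNne : ∀ a ∈ pA.support, N a ≠ 0 := by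
    intro a ha h0
    have h' := hBK 0 (by simp)
    have hz : ∏ a ∈ pA.support, ProbabilityTheory.mgf (l a) (N a) 0 ^ (pA a : ℝ) = 0 := by
      refine Finset.prod_eq_zero ha ?_
      rw [h0, ProbabilityTheory.mgf_zero_measure, Pi.zero_apply, Real.zero_rpow]
      exact_mod_cast Finsupp.mem_support_iff.1 ha
    linarith
  set G : ℝ → ℝ := fun t => ∑ a ∈ pA.support, (pA a : ℝ) * ProbabilityTheory.cgf (l a) (N a) t
    with hG
  have hGd : ∀ t, HasDerivAt G (∑ a ∈ pA.support, (pA a : ℝ) *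
      ∫ y, l a y ∂((N a).tilted fun y => t * l a y)) t := by
    intro t
    refine HasDerivAt.fun_sum fun a _ => HasDerivAt.const_mul _ ?_
    have ht : t ∈ interior (ProbabilityTheory.integrableExpSet (l a) (N a)) := by simp [hset]
    have hd := (ProbabilityTheory.analyticAt_cgf ht).differentiableAt.hasDerivAt
    rwa [← ProbabilityTheory.integral_tilted_mul_self ht] at hd
  obtain ⟨lam, hlam, hmin⟩ := isCompact_Icc.exists_isMinOn (Set.nonempty_Icc.2 zero_le_one)
    (fun t _ => (hGd t).continuousAt.continuousWithinAt : ContinuousOn G (Set.Icc (0 : ℝ) 1))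
  obtain ⟨hd1, hd2⟩ := first_order_conditions hlam hmin (hGd lam)
  have hZpos : ∀ a ∈ pA.support, 0 < ProbabilityTheory.mgf (l a) (N a) lam := fun a ha =>
    ProbabilityTheory.mgf_pos' (hNne a ha) (hNint a lam)
  refine ⟨B, hB, fun m hm s hs F hF => ?_⟩
  have hsupp : ∀ j, s j ∈ pA.support := fun j => hs.mem_support j
  have hsum := hs.sum_real fun a => ∫ y, l a y ∂((N a).tilted fun y => lam * l a y)
  have hm0 : (0 : ℝ) ≤ m := Nat.cast_nonneg m
  have key := testing_lower_bound hm (P := fun j => P (s j)) (Q := fun j => Q (s j))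
    (A := fun j => A (s j)) (fun j => hAm _) (l := fun j => l (s j)) (fun j => hl _)
    (fun j => by
      rw [hA, ← Measure.restrict_restrict (hBm _), hPQ, restrict_withDensity (hBm _),
        Measure.restrict_restrict (hBm _)])
    hB (fun j y hy => hy.1)
    (fun j h0 => hNne _ (hsupp j) (Measure.restrict_eq_zero.2 h0)) hlam
    (by
      rw [hsum]
      calc (0 : ℝ) ≤ m * _ := mul_nonneg hm0 hd1
        _ = _ := by ring)
    (by
      rw [hsum]
      calc _ = (m : ℝ) * _ := by ring
        _ ≤ 0 := mul_nonpos_of_nonneg_of_nonpos hm0 hd2) hF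
  refine key.trans ?_
  gcongr
  have hprod : ∏ j, ProbabilityTheory.mgf (l (s j)) (N (s j)) lam =
      (∏ a ∈ pA.support, ProbabilityTheory.mgf (l a) (N a) lam ^ (pA a : ℝ)) ^ m := by
    have h1 : ∏ j, ProbabilityTheory.mgf (l (s j)) (N (s j)) lam =
        Real.exp (∑ j, Real.log (ProbabilityTheory.mgf (l (s j)) (N (s j)) lam)) := by
      rw [Real.exp_sum]
      exact Finset.prod_congr rfl fun j _ => (Real.exp_log (hZpos _ (hsupp j))).symm
    rw [h1, hs.sum_real fun a => Real.log (ProbabilityTheory.mgf (l a) (N a) lam),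
      Real.exp_nat_mul, Real.exp_sum]
    congr 1
    refine Finset.prod_congr rfl fun a ha => ?_
    rw [Real.rpow_def_of_pos (hZpos a ha), mul_comm]
  rw [hprod]
  exact pow_le_pow_left₀ hK.le (hBK lam hlam).le m

theorem klDiv_withDensity_eq {T R : Measure ℝ} [IsProbabilityMeasure T] [IsProbabilityMeasure R]
    {g : ℝ → ℝ≥0∞} (hg : Measurable g) (hT : T = R.withDensity g) {u : ℝ → ℝ}
    (hu : ∀ᵐ y ∂T, Real.log (g y).toReal = u y) (hint : Integrable u T) :
    0 ≤ ∫ y, u y ∂T ∧ InformationTheory.klDiv T R = ENNReal.ofReal (∫ y, u y ∂T) := by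
  have hac : T ≪ R := hT ▸ withDensity_absolutelyContinuous _ _
  have hllr : llr T R =ᵐ[T] u := by
    have h := Measure.rnDeriv_withDensity R hg
    rw [← hT] at h
    filter_upwards [hac.ae_le h, hu] with y h1 h2
    rw [llr, h1, h2]
  have hint' : Integrable (llr T R) T := hint.congr hllr.symm
  have htop := InformationTheory.klDiv_ne_top hac hint'
  have h := InformationTheory.toReal_klDiv_of_measure_eq hac (by simp : T Set.univ = R Set.univ)
  rw [integral_congr_ae hllr] at h
  rw [← h]
  exact ⟨ENNReal.toReal_nonneg, (ENNReal.ofReal_toReal htop).symm⟩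

namespace IsCommonPart

variable {P Q : Measure ℝ} [IsProbabilityMeasure P] [IsProbabilityMeasure Q] {S : Set ℝ}
  {l : ℝ → ℝ} {lam : ℝ}

theorem mgf_pos (h : IsCommonPart P Q S l) (hlam : lam ∈ Set.Ioo (0 : ℝ) 1)
    (haff : affinity P Q lam ≠ 0) : 0 < ProbabilityTheory.mgf l (Q.restrict S) lam := by
  rw [h.affinity_eq_mgf hlam] at haff
  exact ENNReal.ofReal_pos.1 (pos_iff_ne_zero.2 haff)

theorem neZero (h : IsCommonPart P Q S l) (hlam : lam ∈ Set.Ioo (0 : ℝ) 1)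
    (haff : affinity P Q lam ≠ 0) : NeZero (Q.restrict S) := by
  refine ⟨fun h0 => ?_⟩
  have := h.mgf_pos hlam haff
  simp [h0] at this

/-- The geometric mixture is the exponentially tilted law. -/
theorem geomMixture_eq (h : IsCommonPart P Q S l) (hlam : lam ∈ Set.Ioo (0 : ℝ) 1)
    (haff : affinity P Q lam ≠ 0) :
    geomMixture P Q lam = (Q.restrict S).tilted fun y => lam * l y := by
  have hZ := h.mgf_pos hlam haff
  have hl := h.measurable
  rw [geomMixture, h.withDensity_geom lam hlam, h.affinity_eq_mgf hlam, Measure.tilted,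
    ← withDensity_smul _ (by fun_prop)]
  congr 1
  funext y
  exact (ENNReal.div_eq_inv_mul.symm.trans (ENNReal.ofReal_div_of_pos hZ).symm)

theorem isProbabilityMeasure_tilted (h : IsCommonPart P Q S l) (hlam : lam ∈ Set.Ioo (0 : ℝ) 1)
    (haff : affinity P Q lam ≠ 0) :
    IsProbabilityMeasure ((Q.restrict S).tilted fun y => lam * l y) := by
  have := h.neZero hlam haff
  exact MeasureTheory.isProbabilityMeasure_tilted
    (integrable_exp_mul_of_mem_Icc h.integrable_exp (Set.Ioo_subset_Icc_self hlam))

theorem integrable_tilted (h : IsCommonPart P Q S l) (hlam : lam ∈ Set.Ioo (0 : ℝ) 1) :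
    Integrable l ((Q.restrict S).tilted fun y => lam * l y) := by
  have := ProbabilityTheory.memLp_tilted_mul
    (Ioo_subset_interior_integrableExpSet h.integrable_exp hlam) 1
  exact memLp_one_iff_integrable.1 (by simpa using this)

theorem ae_mem_tilted {P Q : Measure ℝ} {S : Set ℝ} {l : ℝ → ℝ} {lam : ℝ} (h : IsCommonPart P Q S l) :
    ∀ᵐ y ∂((Q.restrict S).tilted fun y => lam * l y), y ∈ S :=
  (tilted_absolutelyContinuous _ _).ae_le (ae_restrict_mem h.measurableSet)

theorem klDiv_geomMixture_right (h : IsCommonPart P Q S l) (hlam : lam ∈ Set.Ioo (0 : ℝ) 1)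
    (haff : affinity P Q lam ≠ 0) :
    0 ≤ lam * ∫ y, l y ∂((Q.restrict S).tilted fun y => lam * l y) -
        Real.log (ProbabilityTheory.mgf l (Q.restrict S) lam) ∧
      InformationTheory.klDiv (geomMixture P Q lam) Q = ENNReal.ofReal
        (lam * ∫ y, l y ∂((Q.restrict S).tilted fun y => lam * l y) -
          Real.log (ProbabilityTheory.mgf l (Q.restrict S) lam)) := by
  have hT := h.isProbabilityMeasure_tilted hlam haff
  have hZ := h.mgf_pos hlam haff
  have hl := h.measurable
  have hi := h.integrable_tilted hlam
  have key := klDiv_withDensity_eq (R := Q)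
    (T := (Q.restrict S).tilted fun y => lam * l y)
    (g := S.indicator fun y => ENNReal.ofReal (Real.exp (lam * l y) /
      ProbabilityTheory.mgf l (Q.restrict S) lam))
    (u := fun y => lam * l y - Real.log (ProbabilityTheory.mgf l (Q.restrict S) lam))
    (Measurable.indicator (by fun_prop) h.measurableSet)
    (by rw [withDensity_indicator h.measurableSet]; rfl)
    (by
      filter_upwards [h.ae_mem_tilted] with y hy
      rw [Set.indicator_of_mem hy, ENNReal.toReal_ofReal (by positivity),
        Real.log_div (Real.exp_pos _).ne' hZ.ne', Real.log_exp])
    ((hi.const_mul _).sub (integrable_const _))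
  rw [integral_sub (hi.const_mul _) (integrable_const _), integral_const_mul, integral_const] at key
  rw [h.geomMixture_eq hlam haff]
  simpa using key

theorem klDiv_geomMixture_left (h : IsCommonPart P Q S l) (hlam : lam ∈ Set.Ioo (0 : ℝ) 1)
    (haff : affinity P Q lam ≠ 0) :
    0 ≤ (lam - 1) * ∫ y, l y ∂((Q.restrict S).tilted fun y => lam * l y) -
        Real.log (ProbabilityTheory.mgf l (Q.restrict S) lam) ∧
      InformationTheory.klDiv (geomMixture P Q lam) P = ENNReal.ofReal
        ((lam - 1) * ∫ y, l y ∂((Q.restrict S).tilted fun y => lam * l y) -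
          Real.log (ProbabilityTheory.mgf l (Q.restrict S) lam)) := by
  have hT := h.isProbabilityMeasure_tilted hlam haff
  have hZ := h.mgf_pos hlam haff
  have hl := h.measurable
  have hi := h.integrable_tilted hlam
  have key := klDiv_withDensity_eq (R := P)
    (T := (Q.restrict S).tilted fun y => lam * l y)
    (g := S.indicator fun y => ENNReal.ofReal (Real.exp ((lam - 1) * l y) /
      ProbabilityTheory.mgf l (Q.restrict S) lam))
    (u := fun y => (lam - 1) * l y - Real.log (ProbabilityTheory.mgf l (Q.restrict S) lam))
    (Measurable.indicator (by fun_prop) h.measurableSet)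
    (by
      rw [withDensity_indicator h.measurableSet, h.restrict_eq,
        ← withDensity_mul _ (by fun_prop) (by fun_prop), Measure.tilted]
      congr 1
      funext y
      rw [Pi.mul_apply, ← ENNReal.ofReal_mul (Real.exp_pos _).le, mul_div_assoc', ← Real.exp_add]
      congr 3
      ring)
    (by
      filter_upwards [h.ae_mem_tilted] with y hy
      rw [Set.indicator_of_mem hy, ENNReal.toReal_ofReal (by positivity),
        Real.log_div (Real.exp_pos _).ne' hZ.ne', Real.log_exp])
    ((hi.const_mul _).sub (integrable_const _))
  rw [integral_sub (hi.const_mul _) (integrable_const _), integral_const_mul, integral_const] at key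
  rw [h.geomMixture_eq hlam haff]
  simpa using key

/-- The logarithm of the affinity lies above its tangents. -/
theorem le_affinity (h : IsCommonPart P Q S l) (hlam : lam ∈ Set.Ioo (0 : ℝ) 1)
    (haff : affinity P Q lam ≠ 0) {t : ℝ} (ht : t ∈ Set.Ioo (0 : ℝ) 1) :
    ENNReal.ofReal (Real.exp (Real.log (ProbabilityTheory.mgf l (Q.restrict S) lam) +
      (t - lam) * ∫ y, l y ∂((Q.restrict S).tilted fun y => lam * l y))) ≤ affinity P Q t := by
  have hT := h.isProbabilityMeasure_tilted hlam haff
  have hZ := h.mgf_pos hlam haff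
  have hi := h.integrable_tilted hlam
  set N := Q.restrict S with hN
  set e := ∫ y, l y ∂(N.tilted fun y => lam * l y) with he
  set Z := ProbabilityTheory.mgf l N lam with hZdef
  have hexp : ∀ y, Real.exp (lam * l y) / Z * (1 + (t - lam) * (l y - e)) ≤
      Real.exp (t * l y) * (Real.exp (-((t - lam) * e)) / Z) := by
    intro y
    calc _ ≤ Real.exp (lam * l y) / Z * Real.exp ((t - lam) * (l y - e)) := by
          gcongr
          linarith [Real.add_one_le_exp ((t - lam) * (l y - e))]
      _ = _ := by
          rw [div_mul_eq_mul_div, mul_div_assoc', ← Real.exp_add, ← Real.exp_add]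
          congr 2
          ring
  have hi1 : Integrable (fun y => 1 + (t - lam) * (l y - e)) (N.tilted fun y => lam * l y) :=
    (integrable_const _).add ((hi.sub (integrable_const _)).const_mul _)
  have hone : ∫ y, (1 + (t - lam) * (l y - e)) ∂(N.tilted fun y => lam * l y) = 1 := by
    have hi2 : Integrable (fun y => l y - e) (N.tilted fun y => lam * l y) :=
      hi.sub (integrable_const _)
    rw [integral_add (integrable_const _) (hi2.const_mul _),
      integral_const_mul, integral_sub hi (integrable_const _)]
    simp [he]
  have hle : 1 ≤ ProbabilityTheory.mgf l N t * (Real.exp (-((t - lam) * e)) / Z) := by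
    rw [← hone, ProbabilityTheory.integral_tilted_mul_eq_mgf, ProbabilityTheory.mgf.eq_1 l N t,
      ← integral_mul_const]
    refine integral_mono ?_ ?_ fun y => hexp y
    · have := (integrable_tilted_iff (integrable_exp_mul_of_mem_Icc h.integrable_exp
        (Set.Ioo_subset_Icc_self hlam)) (g := fun y => 1 + (t - lam) * (l y - e))).1 hi1
      refine (this.div_const Z).congr (ae_of_all _ fun y => ?_)
      simp only [smul_eq_mul]
      ring
    · exact (integrable_exp_mul_of_mem_Icc h.integrable_exp
        (Set.Ioo_subset_Icc_self ht)).mul_const _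
  rw [h.affinity_eq_mgf ht]
  refine ENNReal.ofReal_le_ofReal ?_
  rw [Real.exp_add, Real.exp_log hZ]
  rw [Real.exp_neg, mul_div_assoc', le_div_iff₀ hZ, one_mul, ← div_eq_mul_inv,
    le_div_iff₀ (Real.exp_pos _)] at hle
  exact hle

end IsCommonPart

section Endpoints

variable (P Q : Measure ℝ) [IsProbabilityMeasure P] [IsProbabilityMeasure Q]

theorem withDensity_geomDensity_zero : (P + Q).withDensity (geomDensity P Q 0) = Q := by
  have : geomDensity P Q 0 = Q.rnDeriv (P + Q) := by funext y; simp [geomDensity]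
  rw [this]
  exact Measure.withDensity_rnDeriv_eq _ _
    (Measure.absolutelyContinuous_of_le (Measure.le_add_left le_rfl))

theorem withDensity_geomDensity_one : (P + Q).withDensity (geomDensity P Q 1) = P := by
  have : geomDensity P Q 1 = P.rnDeriv (P + Q) := by funext y; simp [geomDensity]
  rw [this]
  exact Measure.withDensity_rnDeriv_eq _ _ (Measure.AbsolutelyContinuous.rfl.add_right _)

theorem affinity_zero : affinity P Q 0 = 1 := by
  rw [affinity, ← setLIntegral_univ, ← withDensity_apply _ MeasurableSet.univ,
    withDensity_geomDensity_zero, measure_univ]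

theorem affinity_one : affinity P Q 1 = 1 := by
  rw [affinity, ← setLIntegral_univ, ← withDensity_apply _ MeasurableSet.univ,
    withDensity_geomDensity_one, measure_univ]

theorem geomMixture_zero : geomMixture P Q 0 = Q := by
  rw [geomMixture, affinity_zero, withDensity_geomDensity_zero, inv_one, one_smul]

theorem geomMixture_one : geomMixture P Q 1 = P := by
  rw [geomMixture, affinity_one, withDensity_geomDensity_one, inv_one, one_smul]

theorem affinity_self {lam : ℝ} (hlam : lam ∈ Set.Icc (0 : ℝ) 1) : affinity P P lam = 1 := by
  have h := lintegral_geom_withDensity (ν := P) (P := P) (Q := P) (f := 1) (g := 1)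
    measurable_one measurable_one withDensity_one.symm withDensity_one.symm hlam
  simp only [Pi.one_apply, ENNReal.one_rpow, mul_one, lintegral_const, measure_univ] at h
  exact h

end Endpoints

section Mean

variable {n : ℕ} {pA : (Fin n → ℝ) →₀ ℝ≥0} {P Q : (Fin n → ℝ) → Measure ℝ}

theorem outerChernoff_eq_of_isMin {lam D : ℝ} (hlam : lam ∈ Set.Icc (0 : ℝ) 1)
    (heq : meanAffinity pA P Q lam = ENNReal.ofReal (Real.exp (-D)))
    (hmin : ∀ t ∈ Set.Icc (0 : ℝ) 1, ENNReal.ofReal (Real.exp (-D)) ≤ meanAffinity pA P Q t) :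
    outerChernoff pA P Q = (D : EReal) := by
  have hlog : ENNReal.log (ENNReal.ofReal (Real.exp (-D))) = ((-D : ℝ) : EReal) := by
    rw [ENNReal.log_ofReal_of_pos (Real.exp_pos _), Real.log_exp]
  have : ⨅ t ∈ Set.Icc (0 : ℝ) 1, ENNReal.log (meanAffinity pA P Q t) = ((-D : ℝ) : EReal) := by
    rw [← hlog]
    refine le_antisymm (iInf₂_le_of_le lam hlam (by rw [heq])) (le_iInf₂ fun t ht => ?_)
    exact ENNReal.log_le_log (hmin t ht)
  rw [outerChernoff_eq, this, EReal.coe_neg, neg_neg]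

theorem meanDiv_eq_ofReal {R : (Fin n → ℝ) → Measure ℝ} {lam : ℝ} {D : (Fin n → ℝ) → ℝ}
    (h : ∀ a ∈ pA.support, 0 ≤ D a ∧
      InformationTheory.klDiv (geomMixture (P a) (Q a) lam) (R a) = ENNReal.ofReal (D a)) :
    meanDiv pA P Q R lam = ENNReal.ofReal (∑ a ∈ pA.support, (pA a : ℝ) * D a) := by
  rw [ENNReal.ofReal_sum_of_nonneg fun a ha => mul_nonneg (pA a).coe_nonneg (h a ha).1]
  refine Finset.sum_congr rfl fun a ha => ?_
  rw [ENNReal.ofReal_mul (pA a).coe_nonneg, ENNReal.ofReal_coe_nnreal, ← (h a ha).2]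

variable [∀ a, IsProbabilityMeasure (P a)] [∀ a, IsProbabilityMeasure (Q a)]

theorem meanAffinity_eq_one_of_endpoint {lam : ℝ} (h : lam = 0 ∨ lam = 1) :
    meanAffinity pA P Q lam = 1 := by
  refine Finset.prod_eq_one fun a _ => ?_
  rcases h with rfl | rfl
  · rw [affinity_zero, ENNReal.one_rpow]
  · rw [affinity_one, ENNReal.one_rpow]

theorem outerChernoff_eq_zero {P Q : (Fin n → ℝ) → Measure ℝ} [∀ a, IsProbabilityMeasure (Q a)]
    (h : ∀ a ∈ pA.support, P a = Q a) : outerChernoff pA P Q = 0 := by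
  have hone : ∀ t ∈ Set.Icc (0 : ℝ) 1, meanAffinity pA P Q t = 1 := fun t ht =>
    Finset.prod_eq_one fun a ha => by rw [h a ha, affinity_self _ ht, ENNReal.one_rpow]
  have := outerChernoff_eq_of_isMin (pA := pA) (P := P) (Q := Q) (lam := 0) (D := 0) (by simp)
    (by rw [hone 0 (by simp)]; simp) fun t ht => by rw [hone t ht]; simp
  simpa using this

theorem forall_klDiv_eq_zero {R T : (Fin n → ℝ) → Measure ℝ}
    (h : ∑ a ∈ pA.support, (pA a : ℝ≥0∞) * InformationTheory.klDiv (R a) (T a) = 0) :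
    ∀ a ∈ pA.support, InformationTheory.klDiv (R a) (T a) = 0 := by
  intro a ha
  have := (Finset.sum_eq_zero_iff.1 h) a ha
  rcases mul_eq_zero.1 this with h0 | h0
  · exact absurd (by exact_mod_cast h0) (Finsupp.mem_support_iff.1 ha)
  · exact h0

/-- At a balanced parameter, the outer conditional Chernoff information is the mean divergence. -/
theorem IsBalanced.outerChernoff_eq {lam : ℝ} (h : IsBalanced pA P Q lam) :
    outerChernoff pA P Q = (meanDiv pA P Q P lam : EReal) := by
  obtain ⟨hlam, haff, hbal⟩ := h
  rcases eq_or_lt_of_le hlam.1 with h0 | h0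
  · subst h0
    have hQ : meanDiv pA P Q Q 0 = 0 := by
      simp [meanDiv, Finsupp.sum, geomMixture_zero, InformationTheory.klDiv_self]
    rw [hQ] at hbal
    rw [hbal, EReal.coe_ennreal_zero]
    simp only [meanDiv, Finsupp.sum, geomMixture_zero] at hbal
    exact outerChernoff_eq_zero fun a ha =>
      (InformationTheory.klDiv_eq_zero_iff.1 (forall_klDiv_eq_zero hbal a ha)).symm
  rcases eq_or_lt_of_le hlam.2 with h1 | h1
  · subst h1
    have hP : meanDiv pA P Q P 1 = 0 := by
      simp [meanDiv, Finsupp.sum, geomMixture_one, InformationTheory.klDiv_self]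
    rw [hP] at hbal
    rw [hP, EReal.coe_ennreal_zero]
    simp only [meanDiv, Finsupp.sum, geomMixture_one] at hbal
    exact outerChernoff_eq_zero fun a ha =>
      InformationTheory.klDiv_eq_zero_iff.1 (forall_klDiv_eq_zero hbal.symm a ha)
  have hI : lam ∈ Set.Ioo (0 : ℝ) 1 := ⟨h0, h1⟩
  choose S l hSl using fun a => exists_isCommonPart (P a) (Q a)
  set e : (Fin n → ℝ) → ℝ := fun a =>
    ∫ y, l a y ∂(((Q a).restrict (S a)).tilted fun y => lam * l a y) with he
  set z : (Fin n → ℝ) → ℝ := fun a =>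
    Real.log (ProbabilityTheory.mgf (l a) ((Q a).restrict (S a)) lam) with hz
  have hL : ∀ a ∈ pA.support, 0 ≤ (lam - 1) * e a - z a ∧
      InformationTheory.klDiv (geomMixture (P a) (Q a) lam) (P a) =
        ENNReal.ofReal ((lam - 1) * e a - z a) := fun a ha =>
    (hSl a).klDiv_geomMixture_left hI (haff a ha)
  have hR : ∀ a ∈ pA.support, 0 ≤ lam * e a - z a ∧
      InformationTheory.klDiv (geomMixture (P a) (Q a) lam) (Q a) =
        ENNReal.ofReal (lam * e a - z a) := fun a ha =>
    (hSl a).klDiv_geomMixture_right hI (haff a ha)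
  have hmL := meanDiv_eq_ofReal hL
  have hmR := meanDiv_eq_ofReal hR
  have hnL : 0 ≤ ∑ a ∈ pA.support, (pA a : ℝ) * ((lam - 1) * e a - z a) :=
    Finset.sum_nonneg fun a ha => mul_nonneg (pA a).coe_nonneg (hL a ha).1
  have hnR : 0 ≤ ∑ a ∈ pA.support, (pA a : ℝ) * (lam * e a - z a) :=
    Finset.sum_nonneg fun a ha => mul_nonneg (pA a).coe_nonneg (hR a ha).1
  have heq : ∑ a ∈ pA.support, (pA a : ℝ) * ((lam - 1) * e a - z a) =
      ∑ a ∈ pA.support, (pA a : ℝ) * (lam * e a - z a) := by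
    rw [hmL, hmR] at hbal
    exact (ENNReal.ofReal_eq_ofReal_iff hnL hnR).1 hbal
  have he0 : ∑ a ∈ pA.support, (pA a : ℝ) * e a = 0 := by
    rw [← sub_eq_zero, ← Finset.sum_sub_distrib] at heq
    rw [← neg_eq_zero, ← heq, ← Finset.sum_neg_distrib]
    exact Finset.sum_congr rfl fun a _ => by ring
  have hD : ∑ a ∈ pA.support, (pA a : ℝ) * ((lam - 1) * e a - z a) =
      -∑ a ∈ pA.support, (pA a : ℝ) * z a := by
    have : ∀ a ∈ pA.support, (pA a : ℝ) * ((lam - 1) * e a - z a) =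
        (lam - 1) * ((pA a : ℝ) * e a) - (pA a : ℝ) * z a := fun a _ => by ring
    rw [Finset.sum_congr rfl this, Finset.sum_sub_distrib, ← Finset.mul_sum, he0]
    ring
  rw [hmL, EReal.coe_ennreal_ofReal, max_eq_left hnL]
  rw [hD] at hnL ⊢
  have hprod : ∀ u : (Fin n → ℝ) → ℝ,
      ∏ a ∈ pA.support, ENNReal.ofReal (Real.exp (u a)) ^ (pA a : ℝ) =
        ENNReal.ofReal (Real.exp (∑ a ∈ pA.support, (pA a : ℝ) * u a)) := by
    intro u
    rw [Real.exp_sum, ENNReal.ofReal_prod_of_nonneg fun _ _ => (Real.exp_pos _).le]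
    refine Finset.prod_congr rfl fun a _ => ?_
    rw [ENNReal.ofReal_rpow_of_pos (Real.exp_pos _), ← Real.exp_mul, mul_comm]
  refine outerChernoff_eq_of_isMin hlam ?_ fun t ht => ?_
  · rw [neg_neg, ← hprod]
    refine Finset.prod_congr rfl fun a ha => ?_
    rw [(hSl a).affinity_eq_mgf hI, hz, Real.exp_log ((hSl a).mgf_pos hI (haff a ha))]
  · rcases eq_or_lt_of_le ht.1 with h0 | h0
    · rw [meanAffinity_eq_one_of_endpoint (Or.inl h0.symm), ENNReal.ofReal_le_one,
        Real.exp_le_one_iff]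
      linarith
    rcases eq_or_lt_of_le ht.2 with h1 | h1
    · rw [meanAffinity_eq_one_of_endpoint (Or.inr h1), ENNReal.ofReal_le_one,
        Real.exp_le_one_iff]
      linarith
    have hsum : - -∑ a ∈ pA.support, (pA a : ℝ) * z a =
        ∑ a ∈ pA.support, (pA a : ℝ) * (z a + (t - lam) * e a) := by
      have : ∀ a ∈ pA.support, (pA a : ℝ) * (z a + (t - lam) * e a) =
          (pA a : ℝ) * z a + (t - lam) * ((pA a : ℝ) * e a) := fun a _ => by ring
      rw [Finset.sum_congr rfl this, Finset.sum_add_distrib, ← Finset.mul_sum, he0]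
      ring
    rw [hsum, ← hprod]
    exact Finset.prod_le_prod' fun a ha => ENNReal.rpow_le_rpow
      ((hSl a).le_affinity hI (haff a ha) ⟨h0, h1⟩) (pA a).coe_nonneg

/-- A balanced parameter exists if the laws are mutually absolutely continuous. -/
theorem exists_isBalanced (hac : ∀ a ∈ pA.support, P a ≪ Q a ∧ Q a ≪ P a) :
    ∃ lam : ℝ, IsBalanced pA P Q lam := by
  choose S l hSl using fun a => exists_isCommonPart (P a) (Q a)
  have hN : ∀ a ∈ pA.support, IsProbabilityMeasure ((Q a).restrict (S a)) := fun a ha => by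
    rw [((hSl a).restrict_eq_self (hac a ha).1 (hac a ha).2).2]
    infer_instance
  have hpos : ∀ a ∈ pA.support, ∀ t ∈ Set.Icc (0 : ℝ) 1,
      0 < ProbabilityTheory.mgf (l a) ((Q a).restrict (S a)) t := fun a ha t ht => by
    have := hN a ha
    exact ProbabilityTheory.mgf_pos (integrable_exp_mul_of_mem_Icc (hSl a).integrable_exp ht)
  set G : ℝ → ℝ := fun t => ∑ a ∈ pA.support,
    (pA a : ℝ) * ProbabilityTheory.cgf (l a) ((Q a).restrict (S a)) t with hG
  have hGc : ContinuousOn G (Set.Icc 0 1) := continuousOn_finsetSum _ fun a ha =>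
    continuousOn_const.mul ((continuousOn_mgf_Icc (hSl a).measurable
      (hSl a).integrable_exp).log fun t ht => (hpos a ha t ht).ne')
  have hG0 : G 0 = 0 := Finset.sum_eq_zero fun a ha => by
    have := hN a ha
    rw [ProbabilityTheory.cgf_zero, mul_zero]
  have hG1 : G 1 = 0 := Finset.sum_eq_zero fun a ha => by
    have h1 : ENNReal.ofReal (ProbabilityTheory.mgf (l a) ((Q a).restrict (S a)) 1) = 1 := by
      rw [← lintegral_exp_mul_eq (hSl a).integrable_exp (by simp)]
      simp only [one_mul]
      rw [← setLIntegral_univ, ← withDensity_apply _ MeasurableSet.univ, ← (hSl a).restrict_eq,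
        ((hSl a).restrict_eq_self (hac a ha).1 (hac a ha).2).1, measure_univ]
    rw [ENNReal.ofReal_eq_one] at h1
    rw [ProbabilityTheory.cgf, h1, Real.log_one, mul_zero]
  have hGd : ∀ t ∈ Set.Ioo (0 : ℝ) 1, HasDerivAt G (∑ a ∈ pA.support, (pA a : ℝ) *
      ∫ y, l a y ∂(((Q a).restrict (S a)).tilted fun y => t * l a y)) t := by
    intro t ht
    refine HasDerivAt.fun_sum fun a _ => HasDerivAt.const_mul _ ?_
    have hti := Ioo_subset_interior_integrableExpSet (hSl a).integrable_exp ht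
    have hd := (ProbabilityTheory.analyticAt_cgf hti).differentiableAt.hasDerivAt
    rwa [← ProbabilityTheory.integral_tilted_mul_self hti] at hd
  obtain ⟨lam, hlam, he0⟩ := exists_hasDerivAt_eq_zero zero_lt_one hGc (hG0.trans hG1.symm) hGd
  have haff : ∀ a ∈ pA.support, affinity (P a) (Q a) lam ≠ 0 := fun a ha => by
    rw [(hSl a).affinity_eq_mgf hlam]
    exact (ENNReal.ofReal_pos.2 (hpos a ha lam (Set.Ioo_subset_Icc_self hlam))).ne'
  refine ⟨lam, Set.Ioo_subset_Icc_self hlam, haff, ?_⟩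
  rw [meanDiv_eq_ofReal fun a ha => (hSl a).klDiv_geomMixture_left hlam (haff a ha),
    meanDiv_eq_ofReal fun a ha => (hSl a).klDiv_geomMixture_right hlam (haff a ha)]
  congr 1
  rw [← sub_eq_zero, ← Finset.sum_sub_distrib, ← neg_eq_zero, ← he0, ← Finset.sum_neg_distrib]
  exact Finset.sum_congr rfl fun a _ => by ring

end Mean

theorem lt_errorRate {m : ℕ} (hm : 0 < m) {p : ℝ≥0∞} {c : ℝ}
    (h : p < ENNReal.ofReal (Real.exp (-(c * m)))) : (c : EReal) < errorRate m p := by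
  have hm' : (0 : EReal) < ((m : ℝ) : EReal) := by exact_mod_cast hm
  rw [errorRate, EReal.lt_div_iff hm' (EReal.coe_ne_top _), EReal.lt_neg_comm]
  have := ENNReal.log_lt_log h
  rwa [ENNReal.log_ofReal_of_pos (Real.exp_pos _), Real.log_exp, EReal.coe_neg, EReal.coe_mul]
    at this

theorem errorRate_lt {m : ℕ} (hm : 0 < m) {p : ℝ≥0∞} {c : ℝ}
    (h : ENNReal.ofReal (Real.exp (-(c * m))) < p) : errorRate m p < (c : EReal) := by
  have hm' : (0 : EReal) < ((m : ℝ) : EReal) := by exact_mod_cast hm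
  rw [errorRate, EReal.div_lt_iff hm' (EReal.coe_ne_top _), EReal.neg_lt_comm]
  have := ENNReal.log_lt_log h
  rwa [ENNReal.log_ofReal_of_pos (Real.exp_pos _), Real.log_exp, EReal.coe_neg, EReal.coe_mul]
    at this

theorem eventually_const_mul_exp_lt {C : ℝ≥0∞} (hC : C ≠ ∞) {c d : ℝ} (hcd : c < d) :
    ∀ᶠ m : ℕ in atTop, C * ENNReal.ofReal (Real.exp (-(d * m))) <
      ENNReal.ofReal (Real.exp (-(c * m))) := by
  have h : Tendsto (fun m : ℕ => (d - c) * (m : ℝ)) atTop atTop :=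
    tendsto_natCast_atTop_atTop.const_mul_atTop (sub_pos.2 hcd)
  filter_upwards [h.eventually_gt_atTop C.toReal] with m hm
  rw [← ENNReal.ofReal_toReal hC, ← ENNReal.ofReal_mul ENNReal.toReal_nonneg]
  refine (ENNReal.ofReal_lt_ofReal_iff (Real.exp_pos _)).2 ?_
  have h1 : C.toReal < Real.exp ((d - c) * m) := by
    linarith [Real.add_one_le_exp ((d - c) * (m : ℝ))]
  calc _ < Real.exp ((d - c) * m) * Real.exp (-(d * m)) :=
        mul_lt_mul_of_pos_right h1 (Real.exp_pos _)
    _ = _ := by rw [← Real.exp_add]; ring_nf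

/-- Exponential bounds for a sequence of probabilities determine its exponent. -/
theorem tendsto_errorRate {M : Set ℕ} {x : ℕ → ℝ≥0∞} {E : EReal}
    (hupper : ∀ c : ℝ, (c : EReal) < E → ∃ C : ℝ≥0∞, C ≠ ∞ ∧ ∀ m ∈ M,
      x m ≤ C * ENNReal.ofReal (Real.exp (-(c * m))))
    (hlower : ∀ c : ℝ, E < (c : EReal) → ∃ C : ℝ≥0∞, C ≠ 0 ∧ C ≠ ∞ ∧
      ∀ᶠ m : ℕ in atTop, m ∈ M → C * ENNReal.ofReal (Real.exp (-(c * m))) ≤ x m) :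
    Tendsto (fun m => errorRate m (x m)) (atTop ⊓ 𝓟 M) (𝓝 E) := by
  rw [tendsto_order]
  constructor
  · intro a ha
    obtain ⟨c, hac, hcE⟩ := EReal.lt_iff_exists_real_btwn.1 ha
    obtain ⟨d, hcd, hdE⟩ := EReal.lt_iff_exists_real_btwn.1 hcE
    obtain ⟨C, hC, hx⟩ := hupper d hdE
    rw [eventually_inf_principal]
    filter_upwards [eventually_const_mul_exp_lt hC (EReal.coe_lt_coe_iff.1 hcd),
      eventually_gt_atTop 0] with m h1 hm hmM
    exact hac.trans (lt_errorRate hm ((hx m hmM).trans_lt h1))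
  · intro a ha
    obtain ⟨c, hEc, hca⟩ := EReal.lt_iff_exists_real_btwn.1 ha
    obtain ⟨d, hEd, hdc⟩ := EReal.lt_iff_exists_real_btwn.1 hEc
    obtain ⟨C, hC0, hC, hx⟩ := hlower d hEd
    rw [eventually_inf_principal]
    filter_upwards [eventually_const_mul_exp_lt (ENNReal.inv_ne_top.2 hC0)
      (EReal.coe_lt_coe_iff.1 hdc), eventually_gt_atTop 0, hx] with m h1 hm hxm hmM
    refine (errorRate_lt hm (lt_of_lt_of_le ?_ (hxm hmM))).trans hca
    calc _ = C * (C⁻¹ * ENNReal.ofReal (Real.exp (-(c * m)))) := by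
          rw [← mul_assoc, ENNReal.mul_inv_cancel hC0 hC, one_mul]
      _ < _ := (ENNReal.mul_lt_mul_iff_right hC0 hC).2 h1

theorem bayesError_le_worstError {n m k : ℕ} {f₁ f₂ : Measure ℝ} (s : Fin m → Fin n → ℝ)
    (prior : PMF (Hypothesis n k)) (φ : DecisionRule n m) : bayesError f₁ f₂ s prior φ ≤ worstError k f₁ f₂ s φ := by
  calc bayesError f₁ f₂ s prior φ
      ≤ ∑ v : Hypothesis n k, prior v * worstError k f₁ f₂ s φ :=
        Finset.sum_le_sum fun v _ => mul_le_mul' le_rfl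
          (le_iSup (fun v : Hypothesis n k => errorProb f₁ f₂ s φ v.1) v)
    _ = worstError k f₁ f₂ s φ := by
        rw [← Finset.sum_mul, ← tsum_fintype (L := .unconditional _), prior.tsum_coe, one_mul]

theorem mul_worstError_le_bayesError {n m k : ℕ} {f₁ f₂ : Measure ℝ} (s : Fin m → Fin n → ℝ)
    (prior : PMF (Hypothesis n k)) {δ : ℝ≥0∞} (hδ : ∀ v, δ ≤ prior v) (φ : DecisionRule n m) :
    δ * worstError k f₁ f₂ s φ ≤ bayesError f₁ f₂ s prior φ := by
  rw [worstError, ENNReal.mul_iSup]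
  refine iSup_le fun v => (mul_le_mul' (hδ v) le_rfl).trans ?_
  exact Finset.single_le_sum (f := fun v : Hypothesis n k => prior v * errorProb f₁ f₂ s φ v.1)
    (fun _ _ => zero_le) (Finset.mem_univ v)

section Exponent

variable {n k : ℕ} {f₁ f₂ : Measure ℝ} [IsProbabilityMeasure f₁] [IsProbabilityMeasure f₂]
  {pA : (Fin n → ℝ) →₀ ℝ≥0}

theorem exists_meanAffinity_le {P Q : (Fin n → ℝ) → Measure ℝ} {c : ℝ}
    (h : (c : EReal) < outerChernoff pA P Q) :
    ∃ lam ∈ Set.Icc (0 : ℝ) 1, meanAffinity pA P Q lam ≤ ENNReal.ofReal (Real.exp (-c)) := by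
  rw [outerChernoff_eq, EReal.lt_neg_comm] at h
  obtain ⟨lam, h'⟩ := iInf_lt_iff.1 h
  obtain ⟨hlam, hlt⟩ := iInf_lt_iff.1 h'
  refine ⟨lam, hlam, ENNReal.log_le_log_iff.1 ?_⟩
  rw [ENNReal.log_ofReal_of_pos (Real.exp_pos _), Real.log_exp, EReal.coe_neg]
  exact hlt.le

theorem le_meanAffinity {P Q : (Fin n → ℝ) → Measure ℝ} {c : ℝ}
    (h : outerChernoff pA P Q < (c : EReal)) {lam : ℝ} (hlam : lam ∈ Set.Icc (0 : ℝ) 1) :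
    ENNReal.ofReal (Real.exp (-c)) ≤ meanAffinity pA P Q lam := by
  rw [outerChernoff_eq, EReal.neg_lt_comm] at h
  refine ENNReal.log_le_log_iff.1 ?_
  rw [ENNReal.log_ofReal_of_pos (Real.exp_pos _), Real.log_exp, EReal.coe_neg]
  exact h.le.trans (iInf₂_le lam hlam)

/-- The exponent is attained by likelihood ratio tests. -/
theorem exists_worstError_le {c : ℝ} (hc : (c : EReal) < minOuterChernoff k f₁ f₂ pA) :
    ∃ C : ℝ≥0∞, C ≠ ∞ ∧ ∀ (m : ℕ) (s : Fin m → Fin n → ℝ), IsSchedule pA s →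
      ∀ φ : DecisionRule n m, IsLikelihoodRatioTest k f₁ f₂ s φ →
        worstError k f₁ f₂ s φ ≤ C * ENNReal.ofReal (Real.exp (-(c * m))) := by
  classical
  have hlam : ∀ v w : Hypothesis n k, ∃ lam ∈ Set.Icc (0 : ℝ) 1, v ≠ w →
      meanAffinity pA (obsLaw f₁ f₂ v.1) (obsLaw f₁ f₂ w.1) lam ≤
        ENNReal.ofReal (Real.exp (-c)) := by
    intro v w
    by_cases hvw : v = w
    · exact ⟨0, by simp, fun h => absurd hvw h⟩
    · obtain ⟨lam, hlam, h⟩ := exists_meanAffinity_le (hc.trans_le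
        ((iInf_le _ v).trans ((iInf_le _ w).trans (iInf_le _ hvw))))
      exact ⟨lam, hlam, fun _ => h⟩
  choose lam hlam hle using hlam
  refine ⟨Fintype.card (Hypothesis n k), ENNReal.natCast_ne_top _, fun m s hs φ hφ =>
    iSup_le fun v => ?_⟩
  calc errorProb f₁ f₂ s φ v.1
      ≤ ∑ w ∈ Finset.univ.erase v,
          meanAffinity pA (obsLaw f₁ f₂ v.1) (obsLaw f₁ f₂ w.1) (lam v w) ^ m :=
        hφ.errorProb_le hs v (hlam v)
    _ ≤ ∑ _w ∈ Finset.univ.erase v, ENNReal.ofReal (Real.exp (-c)) ^ m :=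
        Finset.sum_le_sum fun w hw =>
          pow_le_pow_left' (hle v w (Finset.ne_of_mem_erase hw).symm) m
    _ ≤ ∑ _w : Hypothesis n k, ENNReal.ofReal (Real.exp (-c)) ^ m :=
        Finset.sum_le_sum_of_subset (Finset.erase_subset _ _)
    _ = _ := by
        rw [Finset.sum_const, nsmul_eq_mul, Finset.card_univ,
          ← ENNReal.ofReal_pow (Real.exp_pos _).le, ← Real.exp_nat_mul]
        ring_nf

/-- No decision rule has a better exponent. -/
theorem eventually_le_worstError {c : ℝ} (hc : minOuterChernoff k f₁ f₂ pA < (c : EReal)) :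
    ∀ᶠ m : ℕ in atTop, ∀ s : Fin m → Fin n → ℝ, IsSchedule pA s → ∀ φ : DecisionRule n m,
      4⁻¹ * ENNReal.ofReal (Real.exp (-(c * m))) ≤ worstError k f₁ f₂ s φ := by
  obtain ⟨v, hv⟩ := iInf_lt_iff.1 hc
  obtain ⟨w, hw⟩ := iInf_lt_iff.1 hv
  obtain ⟨hvw, hlt⟩ := iInf_lt_iff.1 hw
  obtain ⟨d, hd, hdc⟩ := EReal.lt_iff_exists_real_btwn.1 hlt
  obtain ⟨d', hd', hdd'⟩ := EReal.lt_iff_exists_real_btwn.1 hd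
  rw [EReal.coe_lt_coe_iff] at hdc hdd'
  obtain ⟨B, hB, hBm⟩ := exists_schedule_lower_bound (pA := pA) (obsLaw f₁ f₂ v.1)
    (obsLaw f₁ f₂ w.1) (K := Real.exp (-d)) (K₀ := Real.exp (-d')) (Real.exp_pos _)
    (Real.exp_lt_exp.2 (by linarith))
    fun lam hlam => le_meanAffinity hd' (Set.Ioo_subset_Icc_self hlam)
  have hsqrt : Tendsto (fun m : ℕ => (c - d) * √(m : ℝ)) atTop atTop :=
    (Real.tendsto_sqrt_atTop.comp tendsto_natCast_atTop_atTop).const_mul_atTop (sub_pos.2 hdc)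
  filter_upwards [eventually_gt_atTop 0, hsqrt.eventually_ge_atTop (2 * B)] with m hm hmB s hs φ
  set F : Set (Fin m → ℝ) := {y | φ.1 y ≠ v.1} with hF
  have hFm : MeasurableSet F := (φ.2 v.1).compl
  have key := hBm m hm s hs F hFm
  have hv' : Measure.pi (fun j => obsLaw f₁ f₂ v.1 (s j)) F ≤ worstError k f₁ f₂ s φ :=
    le_iSup (fun v : Hypothesis n k => errorProb f₁ f₂ s φ v.1) v
  have hw' : Measure.pi (fun j => obsLaw f₁ f₂ w.1 (s j)) Fᶜ ≤ worstError k f₁ f₂ s φ := by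
    refine le_trans (measure_mono fun y hy => ?_)
      (le_iSup (fun v : Hypothesis n k => errorProb f₁ f₂ s φ v.1) w)
    have hy' : φ.1 y = v.1 := by simpa [hF] using hy
    intro h
    exact hvw (Subtype.ext (hy'.symm.trans h))
  have hexp : Real.exp (2 * B * √m) / Real.exp (-d) ^ m ≤ Real.exp (c * m) := by
    rw [← Real.exp_nat_mul, ← Real.exp_sub, Real.exp_le_exp]
    have h1 : 2 * B * √(m : ℝ) ≤ (c - d) * √(m : ℝ) * √(m : ℝ) :=
      mul_le_mul_of_nonneg_right hmB (Real.sqrt_nonneg _)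
    rw [mul_assoc (c - d), Real.mul_self_sqrt (Nat.cast_nonneg m)] at h1
    linarith
  have h2 : 2⁻¹ ≤ ENNReal.ofReal (Real.exp (c * m)) * (2 * worstError k f₁ f₂ s φ) := by
    refine key.trans (mul_le_mul' (ENNReal.ofReal_le_ofReal hexp) ?_)
    rw [two_mul]
    exact add_le_add hv' hw'
  have hcancel : ENNReal.ofReal (Real.exp (-(c * m))) * ENNReal.ofReal (Real.exp (c * m)) = 1 := by
    rw [← ENNReal.ofReal_mul (Real.exp_pos _).le, ← Real.exp_add]
    simp
  have h4 : (4⁻¹ : ℝ≥0∞) = 2⁻¹ * 2⁻¹ := by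
    rw [← ENNReal.mul_inv (by simp) (by simp)]; norm_num
  calc 4⁻¹ * ENNReal.ofReal (Real.exp (-(c * m)))
      = 2⁻¹ * ENNReal.ofReal (Real.exp (-(c * m))) * 2⁻¹ := by rw [h4]; ring
    _ ≤ 2⁻¹ * ENNReal.ofReal (Real.exp (-(c * m))) *
          (ENNReal.ofReal (Real.exp (c * m)) * (2 * worstError k f₁ f₂ s φ)) :=
        mul_le_mul' le_rfl h2
    _ = (2⁻¹ * 2) * (ENNReal.ofReal (Real.exp (-(c * m))) * ENNReal.ofReal (Real.exp (c * m))) *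
          worstError k f₁ f₂ s φ := by ring
    _ = worstError k f₁ f₂ s φ := by
        rw [hcancel, ENNReal.inv_mul_cancel (by simp) (by simp), one_mul, one_mul]

end Exponent

end CompressedTesting

theorem mainTheorem4 (n k : ℕ) (hk : 0 < k) (hkn : k < n)
    (f₁ f₂ : Measure ℝ) [IsProbabilityMeasure f₁] [IsProbabilityMeasure f₂]
    (pA : (Fin n → ℝ) →₀ ℝ≥0) (hpA : (pA.sum fun _ p => p) = 1)
    (M : Set ℕ) (hM : M.Infinite)
    (s : (m : ℕ) → Fin m → Fin n → ℝ) (hs : ∀ m ∈ M, IsSchedule pA (s m)) :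
    -- the smallest possible worst-case error probability
    Tendsto (fun m => errorRate m (⨅ φ : DecisionRule n m, worstError k f₁ f₂ (s m) φ))
        (atTop ⊓ 𝓟 M) (𝓝 (minOuterChernoff k f₁ f₂ pA)) ∧
    -- the smallest possible average error probability, for every prior without null hypotheses
    (∀ prior : PMF (Hypothesis n k), (∀ v, prior v ≠ 0) →
      Tendsto (fun m => errorRate m (⨅ φ : DecisionRule n m, bayesError f₁ f₂ (s m) prior φ))
        (atTop ⊓ 𝓟 M) (𝓝 (minOuterChernoff k f₁ f₂ pA))) ∧
    -- the likelihood ratio test attains the exponent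
    (∀ φ : (m : ℕ) → DecisionRule n m,
      (∀ m ∈ M, IsLikelihoodRatioTest k f₁ f₂ (s m) (φ m)) →
      Tendsto (fun m => errorRate m (worstError k f₁ f₂ (s m) (φ m)))
        (atTop ⊓ 𝓟 M) (𝓝 (minOuterChernoff k f₁ f₂ pA))) ∧
    -- the outer conditional Chernoff information is the common value of the mean divergences
    (∀ v w : Hypothesis n k, ∀ lam : ℝ,
      IsBalanced pA (obsLaw f₁ f₂ v.1) (obsLaw f₁ f₂ w.1) lam →
      outerChernoff pA (obsLaw f₁ f₂ v.1) (obsLaw f₁ f₂ w.1) =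
        (meanDiv pA (obsLaw f₁ f₂ v.1) (obsLaw f₁ f₂ w.1) (obsLaw f₁ f₂ v.1) lam : EReal)) ∧
    -- and such a balanced parameter exists when the observation laws have the same null sets
    (∀ v w : Hypothesis n k,
      (∀ a ∈ pA.support, obsLaw f₁ f₂ v.1 a ≪ obsLaw f₁ f₂ w.1 a ∧
        obsLaw f₁ f₂ w.1 a ≪ obsLaw f₁ f₂ v.1 a) →
      ∃ lam : ℝ, IsBalanced pA (obsLaw f₁ f₂ v.1) (obsLaw f₁ f₂ w.1) lam) := by
  have hne : Nonempty (Hypothesis n k) := by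
    obtain ⟨K, -, hK⟩ := Finset.exists_subset_card_eq
      (show k ≤ (Finset.univ : Finset (Fin n)).card by simpa using hkn.le)
    exact ⟨⟨K, hK⟩⟩
  have hupper : ∀ c : ℝ, (c : EReal) < minOuterChernoff k f₁ f₂ pA → ∃ C : ℝ≥0∞, C ≠ ∞ ∧
      ∀ m ∈ M, (⨅ φ : DecisionRule n m, worstError k f₁ f₂ (s m) φ) ≤
        C * ENNReal.ofReal (Real.exp (-(c * m))) := by
    intro c hc
    obtain ⟨C, hC, h⟩ := exists_worstError_le hc
    refine ⟨C, hC, fun m hm => ?_⟩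
    obtain ⟨φ, hφ⟩ := exists_isLikelihoodRatioTest (k := k) f₁ f₂ (s m)
    exact (iInf_le _ φ).trans (h m (s m) (hs m hm) φ hφ)
  have h4 : (4⁻¹ : ℝ≥0∞) ≠ 0 ∧ (4⁻¹ : ℝ≥0∞) ≠ ∞ := by simp
  refine ⟨?_, fun prior hprior => ?_, fun φ hφ => ?_, fun v w lam h => h.outerChernoff_eq,
    fun v w h => exists_isBalanced h⟩
  · refine tendsto_errorRate hupper fun c hc => ⟨4⁻¹, h4.1, h4.2, ?_⟩
    filter_upwards [eventually_le_worstError hc] with m h hm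
    exact le_iInf fun φ => h (s m) (hs m hm) φ
  · obtain ⟨v₀, hv₀⟩ := Finite.exists_min prior
    refine tendsto_errorRate (fun c hc => ?_) fun c hc =>
      ⟨prior v₀ * 4⁻¹, mul_ne_zero (hprior v₀) h4.1,
        ENNReal.mul_ne_top (prior.apply_ne_top v₀) h4.2, ?_⟩
    · obtain ⟨C, hC, h⟩ := hupper c hc
      exact ⟨C, hC, fun m hm => (iInf_mono fun φ =>
        bayesError_le_worstError (s m) prior φ).trans (h m hm)⟩
    · filter_upwards [eventually_le_worstError hc] with m h hm
      refine le_iInf fun φ => ?_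
      rw [mul_assoc]
      exact (mul_le_mul' le_rfl (h (s m) (hs m hm) φ)).trans
        (mul_worstError_le_bayesError (s m) prior hv₀ φ)
  · refine tendsto_errorRate (fun c hc => ?_) fun c hc => ⟨4⁻¹, h4.1, h4.2, ?_⟩
    · obtain ⟨C, hC, h⟩ := exists_worstError_le hc
      exact ⟨C, hC, fun m hm => h m (s m) (hs m hm) (φ m) (hφ m hm)⟩
    · filter_upwards [eventually_le_worstError hc] with m h hm
      exact h (s m) (hs m hm) (φ m)
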